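/- Let $D$ be an oriented virtual link diagram and $k$ a commutative ring. Let $V=k[X]/(X^2)$ with basis $1,X$, multiplication $m$, comultiplication $\Delta(1)=1\otimes X+X\otimes 1$, $\Delta(X)=X\otimes X$, and bar operation $\overline{1}=1$, $\overline{X}=-X$. A state $s$ of $D$ is a choice of the $A$- or $B$-smoothing at each classical crossing; smoothing gives a collection of cycles, and $C(s)=\bigotimes_{\text{cycles of } s}V$, i.e. the free $k$-module on the labellings of the cycles of $s$ by $1$ and $X$. *Local data.* Draw each classical crossing with both strands pointing upwards. Give it the canonical source-sink orientation: both ends of one fixed strand (say the one from lower left to upper right) point into the crossing and both ends of the other strand point out. Both smoothings of the crossing inherit orientations on their arcs. Put a cut locus on every semi-arc (part of the diagram between consecutive classical crossings) along which the source-sink orientations of its two ends disagree. Label the two arcs of the vertical smoothing $1,2$ (say left, right) and those of the horizontal smoothing $1,2$ (say top, bottom). These conventions are the same at all crossings. *Global data.* For every state choose arbitrarily a marked point (not a cut locus) on each cycle and a total order of the cycles. *Partial differentials.* Let $s$ have an $A$-smoothing at the crossing $\tau$ and let $t$ be the state obtained from $s$ by changing it to the $B$-smoothing. The uncorrected map $C(s)\to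 C(t)$ is $m$ on the two cycles through $\tau$ if they merge, $\Delta$ if one cycle splits (the arcs labelled $1,2$ at $\tau$ giving the two cycles), and the single-cycle map $\eta=0$ if one cycle is turned into one cycle; it is the identity on the labels of the cycles that miss $\tau$. The partial differential $\partial_\tau\colon C(s)\to C(t)$ is this map corrected as follows. 1. (Bars.) It is pre-composed with the bar operation, applied in the factor of each cycle of $s$ through $\tau$ as many times as there are cut loci on a path along the cycle between the smoothing at $\tau$ and the marked point. It is post-composed in the same way for the cycles of $t$ through $\tau$; a cycle that misses $\tau$ belongs to both $s$ and $t$, and in its factor the bar operation is applied as many times as there are cut loci on a path from its marked point in $s$ to its marked point in $t$. 2. (Signs.) The local order of the cycles of $s$ at $\tau$ consists of the cycle through the arc labelled $1$, then the cycle through the arc labelled $2$ if it is a different one, then the remaining cycles in their global order in $s$. The local order of the cycles of $t$ at $\tau$ is formed in the same way, with the remaining cycles (the same curves as in $s$) in the same relative order as in $s$. The map is multiplied by the signs of the permutations that take the local order to the global order, for $s$ and for $t$. Then every face of the cube anti-commutes: for every state $s$ and all crossings $\tau_1\neq\tau_2$ at which $s$ has $A$-smoothings, $$\partial_{\tau_2}\circ\partial_{\tau_1}=-\,\partial_{\tau_1}\circ\partial_{\tau_2}\colon\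 C(s)\to C(s_{12}),$$ where $s_{12}$ is $s$ with both smoothings changed to $B$. Consequently $\partial=\sum_\tau\partial_\tau$ on $\bigoplus_s C(s)$ satisfies $\partial^2=0$. This holds for every commutative ring $k$, for every choice of the global data, and for either choice of the strand pointing in and of the arc labelled $1$ in the vertical and in the horizontal smoothing. -/

import Mathlib

/-!
Khovanov cube of a virtual link diagram with `η = 0`, bar corrections from cut loci and sign
corrections from orderings of the cycles.

An oriented virtual link diagram is recorded by its signed oriented Gauss data.  Draw every
classical crossing with both strands pointing upwards; its four ends are then the corners
`sw`, `se` (incoming) and `nw`, `ne` (outgoing), and the two strands are `sw → ne` and `se → nw`.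
The semi-arcs join outgoing to incoming ends.  Virtual crossings carry no data.
-/

namespace VirtualKhovanov

inductive Corner where
  | sw | se | ne | nw
  deriving DecidableEq

instance : Fintype Corner where
  elems := {.sw, .se, .ne, .nw}
  complete := by intro x; cases x <;> decide

def Corner.Incoming : Corner → Prop
  | .sw => True
  | .se => True
  | .ne => False
  | .nw => False

/-- An oriented virtual link diagram.  `glue` sends an end of a semi-arc to its other end.  A
crossing is positive iff its over-strand is `sw → ne`.  `freeLoops` is the number of link
components without classical crossings. -/
structure Diagram where
  n : ℕ
  positive : Fin n → Prop
  glue : Fin n × Corner → Fin n × Corner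
  glue_glue : ∀ h, glue (glue h) = h
  glue_incoming : ∀ h, (glue h).2.Incoming ↔ ¬ h.2.Incoming
  freeLoops : ℕ

/-- The ends of the semi-arcs at the crossings. -/
abbrev Diagram.HalfEdge (D : Diagram) : Type := Fin D.n × Corner

inductive Smoothing where
  | A | B
  deriving DecidableEq

instance : Fintype Smoothing where
  elems := {.A, .B}
  complete := by intro x; cases x <;> decide

abbrev Diagram.State (D : Diagram) : Type := Fin D.n → Smoothing

/-- The pictures that fix the canonical source-sink orientation and the canonical local order at
an upward oriented crossing.  `risingIn`: both ends of the strand `sw → ne` point into the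
crossing and both ends of `se → nw` point out of it (otherwise the reverse).  `leftFirst`,
`topFirst`: which arc of the vertical, respectively horizontal, smoothing carries the label `1`. -/
structure Convention where
  risingIn : Bool
  leftFirst : Bool
  topFirst : Bool

/-- In the source-sink orientation, the end at this corner points into the crossing. -/
def Convention.PointsIn (κ : Convention) : Corner → Prop
  | .sw => κ.risingIn = true
  | .ne => κ.risingIn = true
  | .se => κ.risingIn = false
  | .nw => κ.risingIn = false

namespace Diagram

variable (D : Diagram)

/-- The state `s` smooths the crossing `c` by the two vertical arcs `sw - nw` and `se - ne`, as
opposed to the two horizontal arcs `sw - se` and `nw - ne`.  At a positive crossing the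
`A`-smoothing is vertical, at a negative crossing the `B`-smoothing is. -/
def Vertical (s : D.State) (c : Fin D.n) : Prop := s c = .A ↔ D.positive c

open Classical in
/-- The other end of the smoothing arc that ends at `h`. -/
noncomputable def smooth (s : D.State) (h : D.HalfEdge) : D.HalfEdge :=
  (h.1,
    if D.Vertical s h.1 then
      match h.2 with
      | .sw => .nw
      | .nw => .sw
      | .se => .ne
      | .ne => .se
    else
      match h.2 with
      | .sw => .se
      | .se => .sw
      | .nw => .ne
      | .ne => .nw)

/-- There is a cut locus on the semi-arc through `h`: the source-sink orientations at its two ends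
point both into, or both out of, the adjacent crossings, so they disagree along the semi-arc. -/
def Cut (κ : Convention) (h : D.HalfEdge) : Prop :=
  κ.PointsIn h.2 ↔ κ.PointsIn (D.glue h).2

open Classical in
/-- `CutPath κ s h h' m`: in the state `s` a path along a cycle leads from `h` to `h'` and crosses
`m` cut loci. -/
inductive CutPath (κ : Convention) (s : D.State) : D.HalfEdge → D.HalfEdge → ℕ → Prop
  | refl (h : D.HalfEdge) : CutPath κ s h h 0
  | smooth {h h' : D.HalfEdge} {m : ℕ} :
      CutPath κ s h h' m → CutPath κ s h (D.smooth s h') m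
  | glue {h h' : D.HalfEdge} {m : ℕ} :
      CutPath κ s h h' m → CutPath κ s h (D.glue h') (m + if D.Cut κ h' then 1 else 0)

/-- The number of cut loci crossed on a path from `h` to `h'`.  Every cycle carries an even number
of cut loci, so the parity does not depend on the path; the least number is taken. -/
noncomputable def cutCount (κ : Convention) (s : D.State) (h h' : D.HalfEdge) : ℕ :=
  sInf {m | D.CutPath κ s h h' m}

def Step (s : D.State) (h h' : D.HalfEdge) : Prop := h' = D.smooth s h ∨ h' = D.glue h

/-- The cycles of a state that pass through crossings. -/
abbrev Loop (s : D.State) : Type := Quot (D.Step s)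

/-- All cycles of a state. -/
abbrev Cycle (s : D.State) : Type := D.Loop s ⊕ Fin D.freeLoops

noncomputable instance instFintypeCycle (s : D.State) : Fintype (D.Cycle s) := Fintype.ofFinite _

/-- The cycle of the state `s` through `h`. -/
def cycleAt (s : D.State) (h : D.HalfEdge) : D.Cycle s := Sum.inl (Quot.mk _ h)

open Classical in
/-- An end of the arc labelled `1` in the smoothing of the crossing `τ`. -/
noncomputable def arc₁ (κ : Convention) (s : D.State) (τ : Fin D.n) : D.HalfEdge :=
  (τ, if D.Vertical s τ then (if κ.leftFirst then .sw else .se)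
      else (if κ.topFirst then .nw else .sw))

open Classical in
/-- An end of the arc labelled `2` in the smoothing of the crossing `τ`. -/
noncomputable def arc₂ (κ : Convention) (s : D.State) (τ : Fin D.n) : D.HalfEdge :=
  (τ, if D.Vertical s τ then (if κ.leftFirst then .se else .sw)
      else (if κ.topFirst then .sw else .nw))

/-- The cycle through the arc labelled `1` at `τ`. -/
noncomputable def cycle₁ (κ : Convention) (s : D.State) (τ : Fin D.n) : D.Cycle s :=
  D.cycleAt s (D.arc₁ κ s τ)

/-- The cycle through the arc labelled `2` at `τ`. -/
noncomputable def cycle₂ (κ : Convention) (s : D.State) (τ : Fin D.n) : D.Cycle s :=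
  D.cycleAt s (D.arc₂ κ s τ)

/-- The arbitrary global choices: for every state, a marked point on each of its cycles (the
global orientation of the cycle is the source-sink orientation at the marked point; a free loop has
no cut loci and needs none) and an ordering of its cycles. -/
structure GlobalChoice where
  star : ∀ s : D.State, D.Loop s → D.HalfEdge
  star_mem : ∀ (s : D.State) (q : D.Loop s), (Quot.mk _ (star s q) : D.Loop s) = q
  order : ∀ s : D.State, D.Cycle s ≃ Fin (Fintype.card (D.Cycle s))

end Diagram

/-- The basis `1, X` of the algebra `V = k[X]/(X²)`. -/
inductive Label where
  | one | X
  deriving DecidableEq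

instance : Fintype Label where
  elems := {.one, .X}
  complete := by intro x; cases x <;> decide

/-- The coefficient of `c` in the product `m (a ⊗ b)`. -/
def mulCoeff (k : Type*) [CommRing k] : Label → Label → Label → k
  | .one, .one, .one => 1
  | .one, .X, .X => 1
  | .X, .one, .X => 1
  | _, _, _ => 0

/-- The coefficient of `b ⊗ c` in the coproduct `Δ a`. -/
def comulCoeff (k : Type*) [CommRing k] : Label → Label → Label → k
  | .one, .one, .X => 1
  | .one, .X, .one => 1
  | .X, .X, .X => 1
  | _, _, _ => 0

/-- The bar operation multiplies the basis vector `1` by `1` and `X` by `-1`. -/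
def barCoeff (k : Type*) [CommRing k] : Label → k
  | .one => 1
  | .X => -1

/-- The sign of the permutation that takes the local order of a finite set, which lists its
elements by increasing `key`, to the global order `e`. -/
def orderSign {α : Type*} {n : ℕ} (e : α ≃ Fin n) (key : α → ℕ) : ℤˣ :=
  Equiv.Perm.sign (Tuple.sort (key ∘ e.symm))

namespace Diagram

variable (k : Type*) [CommRing k] (D : Diagram)

/-- A labelling of the cycles of `s` by `1` and `X`: a basis vector of the tensor product of the
copies of `V` indexed by the cycles. -/
abbrev EnhancedState (s : D.State) : Type := D.Cycle s → Label

noncomputable instance instFintypeEnhancedState (s : D.State) : Fintype (D.EnhancedState s) :=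
  Fintype.ofFinite _

/-- The chain module of a state: the span of its enhanced states. -/
abbrev Chain (s : D.State) : Type _ := D.EnhancedState s →₀ k

variable {D}

/-- Apply the bar operation `f c` times in the tensor factor of each cycle `c`. -/
noncomputable def barMap {s : D.State} (f : D.Cycle s → ℕ) : D.Chain k s →ₗ[k] D.Chain k s :=
  Finsupp.linearCombination k fun l : D.EnhancedState s =>
    Finsupp.single l (∏ c, barCoeff k (l c) ^ f c)

/-- The labellings `l` and `l'` agree on all cycles that do not pass through `τ`. -/
def AgreeOff (κ : Convention) {s t : D.State} (τ : Fin D.n)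
    (l : D.EnhancedState s) (l' : D.EnhancedState t) : Prop :=
  (∀ h : D.HalfEdge, D.cycleAt s h ≠ D.cycle₁ κ s τ → D.cycleAt s h ≠ D.cycle₂ κ s τ →
    l' (D.cycleAt t h) = l (D.cycleAt s h)) ∧
  ∀ i : Fin D.freeLoops, l' (Sum.inr i) = l (Sum.inr i)

open Classical in
/-- The coefficient of `l'` in the uncorrected map for the change of smoothing at `τ` from `s` to
`t`: multiplication if two cycles merge, comultiplication if one cycle splits, and `η = 0` if one
cycle is turned into one cycle. -/
noncomputable def siteCoeff (κ : Convention) {s t : D.State} (τ : Fin D.n)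
    (l : D.EnhancedState s) (l' : D.EnhancedState t) : k :=
  if AgreeOff κ τ l l' then
    if D.cycle₁ κ s τ ≠ D.cycle₂ κ s τ then
      mulCoeff k (l (D.cycle₁ κ s τ)) (l (D.cycle₂ κ s τ)) (l' (D.cycle₁ κ t τ))
    else if D.cycle₁ κ t τ ≠ D.cycle₂ κ t τ then
      comulCoeff k (l (D.cycle₁ κ s τ)) (l' (D.cycle₁ κ t τ)) (l' (D.cycle₂ κ t τ))
    else 0
  else 0

/-- The uncorrected map: `m`, `Δ` or `η` at `τ`. -/
noncomputable def siteMap (κ : Convention) (s t : D.State) (τ : Fin D.n) :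
    D.Chain k s →ₗ[k] D.Chain k t :=
  Finsupp.linearCombination k fun l : D.EnhancedState s =>
    ∑ l' : D.EnhancedState t, Finsupp.single l' (siteCoeff k κ τ l l')

namespace GlobalChoice

variable (g : D.GlobalChoice) (κ : Convention)

/-- The cycle of `s` through the marked point of a cycle of `t`.  If `t` differs from `s` only at
`τ` and the cycle of `t` misses `τ`, this is the same closed curve. -/
def carry (s t : D.State) : D.Cycle t → D.Cycle s
  | Sum.inl q => D.cycleAt s (g.star t q)
  | Sum.inr i => Sum.inr i

/-- The number of cut loci crossed from `h` to the marked point of its cycle. -/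
noncomputable def barsTo (s : D.State) (h : D.HalfEdge) : ℕ :=
  D.cutCount κ s h (g.star s (Quot.mk _ h))

open Classical in
/-- Number of bars in the pre-composition: a cycle through `τ` is transported between its marked
point and the smoothing at `τ`. -/
noncomputable def preBars (s : D.State) (τ : Fin D.n) (c : D.Cycle s) : ℕ :=
  if c = D.cycle₁ κ s τ then g.barsTo κ s (D.arc₁ κ s τ)
  else if c = D.cycle₂ κ s τ then g.barsTo κ s (D.arc₂ κ s τ)
  else 0

open Classical in
/-- Number of bars in the post-composition: a cycle through `τ` is transported from the smoothing
at `τ` to its marked point in `t`; any other cycle is common to `s` and `t` and is transported from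
its marked point in `s` to its marked point in `t`. -/
noncomputable def postBars (s t : D.State) (τ : Fin D.n) (c : D.Cycle t) : ℕ :=
  if c = D.cycle₁ κ t τ then g.barsTo κ t (D.arc₁ κ t τ)
  else if c = D.cycle₂ κ t τ then g.barsTo κ t (D.arc₂ κ t τ)
  else match c with
    | Sum.inl q => g.barsTo κ t (g.star s (Quot.mk _ (g.star t q)))
    | Sum.inr _ => 0

open Classical in
/-- The local order of the cycles of `s` at `τ`: first the cycle labelled `1`, then (if different)
the cycle labelled `2`, then the remaining cycles in their global order. -/
noncomputable def preKey (s : D.State) (τ : Fin D.n) (c : D.Cycle s) : ℕ :=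
  if c = D.cycle₁ κ s τ then 0
  else if c = D.cycle₂ κ s τ then 1
  else 2 + (g.order s c : ℕ)

open Classical in
/-- The local order of the cycles of `t` at `τ` along the edge from `s` to `t`: first the cycle
labelled `1`, then (if different) the cycle labelled `2`, then the remaining cycles, which are
common to `s` and `t`, in the same relative order as in the local order of `s`. -/
noncomputable def postKey (s t : D.State) (τ : Fin D.n) (c : D.Cycle t) : ℕ :=
  if c = D.cycle₁ κ t τ then 0
  else if c = D.cycle₂ κ t τ then 1
  else 2 + (g.order s (g.carry s t c) : ℕ)

/-- The partial differential of the edge `s → t` at `τ`: the map `m`, `Δ` or `η`, pre- and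
post-composed with the bar operations and with the signs of the local-to-global permutations. -/
noncomputable def partialDiff (s t : D.State) (τ : Fin D.n) : D.Chain k s →ₗ[k] D.Chain k t :=
  ((orderSign (g.order t) (g.postKey κ s t τ) * orderSign (g.order s) (g.preKey κ s τ) : ℤˣ) : ℤ) •
    (barMap k (g.postBars κ s t τ) ∘ₗ siteMap k κ s t τ ∘ₗ barMap k (g.preBars κ s τ))

/-- The differential on the sum of the chain modules of all states. -/
noncomputable def differential :
    (∀ s : D.State, D.Chain k s) →ₗ[k] (∀ s : D.State, D.Chain k s) :=
  LinearMap.pi fun t => ∑ τ ∈ Finset.univ.filter (fun τ => t τ = Smoothing.B),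
    g.partialDiff k κ (Function.update t τ .A) t τ ∘ₗ LinearMap.proj (Function.update t τ .A)

end GlobalChoice

end Diagram

end VirtualKhovanov

/-!
A bar before or after the saddle maps turns the label `X` at a point of a cycle into `± X`, the sign
counting the cut loci up to the marked point. After this normalisation the partial differentials
commute with the operators "multiply by `X` at a point", so a face of the cube need only be checked
on the labelling by `1` alone. There a merging saddle gives the labelling by `1` again and a
splitting one the sum of `X` at the corners `sw` and `ne` of the crossing, in both cases times the
permutation signs.

These signs are compared through determinants. A function on the half-edges that is constant on
cycles is a column with one entry for every cycle, in their global order. When a saddle merges two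
cycles, the determinant of such columns is multiplied by the permutation signs and a new column is
needed, whose two corner values differ by one. Going around a face in the two ways exchanges the two
new columns, which gives the minus sign.

This fails to be enough in two cases. If both saddles join or separate the same two cycles, the
columns are the same, and the sign is compared with the directions of the strands by counting the
crossings of the two cycles, an intersection number that vanishes. If an edge of the face is a
single-cycle map, the two arcs have opposite source-sink directions, so the sum of `X` on the other
side of the face is zero, in agreement with `η = 0`.
-/

namespace VirtualKhovanov

/-! ### Involutions and permutations -/

section Permutations

open Equiv.Perm

variable {α : Type*}

theorem sameCycle_mul_apply_apply {a b : Equiv.Perm α} (ha : a * a = 1) (hb : b * b = 1)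
    {x y : α} (h : (a * b).SameCycle x y) : (a * b).SameCycle (b x) (b y) := by
  have hconj : b * (a * b) * b⁻¹ = (a * b)⁻¹ := by
    rw [mul_inv_rev, mul_assoc b, mul_assoc a, mul_inv_cancel, mul_one,
      inv_eq_of_mul_eq_one_left ha, inv_eq_of_mul_eq_one_left hb]
  have := h.conj (g := b)
  rwa [hconj, sameCycle_inv] at this

theorem not_sameCycle_mul_apply {a b : Equiv.Perm α} (ha : a * a = 1) (hb : b * b = 1)
    (ha' : ∀ x, a x ≠ x) (hb' : ∀ x, b x ≠ x) (x : α) : ¬ (a * b).SameCycle x (b x) := by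
  have hsemi : SemiconjBy b (a * b) (a * b)⁻¹ := by
    rw [SemiconjBy, mul_inv_rev, inv_eq_of_mul_eq_one_left ha, inv_eq_of_mul_eq_one_left hb,
      mul_assoc]
  have hpow (n : ℤ) (y : α) : b (((a * b) ^ n) y) = ((a * b) ^ (-n)) (b y) := by
    have := hsemi.zpow_right n
    rw [inv_zpow'] at this
    exact DFunLike.congr_fun this.eq y
  rintro ⟨n, hn⟩
  obtain ⟨m, rfl | rfl⟩ := n.even_or_odd'
  · apply hb' (((a * b) ^ m) x)
    rw [hpow, ← hn, ← mul_apply, ← zpow_add]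
    congr 2
    ring
  · apply ha' (b (((a * b) ^ m) x))
    rw [← mul_apply a b, hpow, ← hn, ← mul_apply, ← mul_apply, ← zpow_add, ← zpow_one_add]
    congr 2
    ring

theorem exists_sign_alternating {a b : Equiv.Perm α} (ha : a * a = 1) (hb : b * b = 1)
    (ha' : ∀ x, a x ≠ x) (hb' : ∀ x, b x ≠ x) :
    ∃ o : α → ℤˣ, (∀ x, o (a x) = -o x) ∧ ∀ x, o (b x) = -o x := by
  classical
  let orbit : α → Quotient (SameCycle.setoid (a * b)) := Quotient.mk _
  let := linearOrderOfSTO (WellOrderingRel (α := Quotient (SameCycle.setoid (a * b))))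
  have haa (x : α) : a (a x) = x := DFunLike.congr_fun ha x
  have hbb (x : α) : b (b x) = x := DFunLike.congr_fun hb x
  have orbit_ne (x : α) : orbit x ≠ orbit (b x) := fun h =>
    not_sameCycle_mul_apply ha hb ha' hb' x (Quotient.exact h)
  have orbit_a (x : α) : orbit (a x) = orbit (b x) :=
    Quotient.sound ⟨-1, by simp [mul_inv_rev, inv_eq_of_mul_eq_one_left ha,
      inv_eq_of_mul_eq_one_left hb, haa]⟩
  have orbit_ba (x : α) : orbit (b (a x)) = orbit x := by rw [← orbit_a, haa]
  refine ⟨fun x => if orbit x < orbit (b x) then 1 else -1, fun x => ?_, fun x => ?_⟩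
  · simp only [orbit_a, orbit_ba]
    rcases (orbit_ne x).lt_or_gt with h | h <;> simp [h, h.not_gt]
  · simp only [hbb]
    rcases (orbit_ne x).lt_or_gt with h | h <;> simp [h, h.not_gt]

theorem not_sameCycle_of_pow_apply_self [Finite α] {f : Equiv.Perm α} {x y : α} {n : ℕ}
    (hn : (f ^ n) x = x) (hn₀ : 0 < n) (h : ∀ i < n, (f ^ i) x ≠ y) : ¬ f.SameCycle x y := by
  intro hxy
  obtain ⟨i, -, hi⟩ := hxy.exists_pow_eq'
  refine h (i % n) (i.mod_lt hn₀) ?_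
  have hper : Function.IsPeriodicPt f n x := by rwa [Function.IsPeriodicPt, Function.IsFixedPt,
    iterate_eq_pow]
  rw [← iterate_eq_pow, hper.iterate_mod_apply, iterate_eq_pow, hi]

/-- Follow `f` from `x` until it first returns to `x` or `y`.  If it returns to `x`, the swap
redirects it to `y`, and conversely. -/
theorem sameCycle_swap_mul_iff [Finite α] [DecidableEq α] (f : Equiv.Perm α) {x y : α}
    (hxy : x ≠ y) : (Equiv.swap x y * f).SameCycle x y ↔ ¬ f.SameCycle x y := by
  have hex : ∃ n, (f ^ (n + 1)) x = x ∨ (f ^ (n + 1)) x = y := by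
    refine ⟨orderOf f - 1, Or.inl ?_⟩
    rw [Nat.sub_add_cancel (orderOf_pos f), pow_orderOf_eq_one, one_apply]
  let n := Nat.find hex
  have hmin (i : ℕ) (hi : i < n) : (f ^ (i + 1)) x ≠ x ∧ (f ^ (i + 1)) x ≠ y :=
    not_or.1 (Nat.find_min hex hi)
  have hne : ∀ i < n + 1, (f ^ i) x ≠ y
    | 0, _ => hxy
    | i + 1, hi => (hmin i (by omega)).2
  have hpow (i : ℕ) (hi : i < n + 1) : ((Equiv.swap x y * f) ^ i) x = (f ^ i) x := by
    induction i with
    | zero => rfl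
    | succ i ih =>
      rw [pow_succ', mul_apply, ih (by omega), mul_apply, ← mul_apply f, ← pow_succ',
        Equiv.swap_apply_of_ne_of_ne (hmin i (by omega)).1 (hmin i (by omega)).2]
  have hlast : ((Equiv.swap x y * f) ^ (n + 1)) x = Equiv.swap x y ((f ^ (n + 1)) x) := by
    rw [pow_succ', mul_apply, hpow n n.lt_succ_self, mul_apply, ← mul_apply f, ← pow_succ']
  rcases Nat.find_spec hex with h | h
  · refine iff_of_true ⟨(n + 1 : ℕ), ?_⟩ (not_sameCycle_of_pow_apply_self h n.succ_pos hne)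
    rw [zpow_natCast, hlast, h, Equiv.swap_apply_left]
  · refine iff_of_false ?_ (not_not.2 ⟨(n + 1 : ℕ), h⟩)
    refine not_sameCycle_of_pow_apply_self (n := n + 1) ?_ n.succ_pos fun i hi => ?_
    · rw [hlast, h, Equiv.swap_apply_right]
    · rw [hpow i hi]
      exact hne i hi

end Permutations

/-! ### Determinants of functions on a finite ordered set -/

section Determinants

open Matrix

theorem det_of_rows_eq_off_zero {R : Type*} [CommRing R] {n : ℕ}
    (A : Matrix (Fin (n + 2)) (Fin (n + 2)) R) (hA : ∀ j : Fin (n + 1), A 0 j.succ = A 1 j.succ) :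
    A.det = (A 0 0 - A 1 0) * (A.submatrix Fin.succ Fin.succ).det := by
  rw [← det_updateRow_add_smul_self A (i := 0) (j := 1) (by simp) (-1), det_succ_row_zero,
    Fin.sum_univ_succ, Finset.sum_eq_zero fun j _ => ?_]
  · have hminor : (updateRow A 0 (A 0 + (-1 : R) • A 1)).submatrix Fin.succ (Fin.succAbove 0) =
        A.submatrix Fin.succ Fin.succ := by
      ext i j
      rw [submatrix_apply, updateRow_ne (Fin.succ_ne_zero i), Fin.succAbove_zero, submatrix_apply]
    rw [hminor]
    simp [sub_eq_add_neg]
  · simp [hA j]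

variable {C C' : Type*} {n : ℕ}

/-- The determinant of `n` functions on a set of `n` elements that is ordered by `e`. -/
def orderedDet (e : C ≃ Fin n) (v : Fin n → C → ℤ) : ℤ := (of fun i j => v j (e.symm i)).det

theorem orderedDet_swap (e : C ≃ Fin (n + 2)) (a b : C → ℤ) (v : Fin n → C → ℤ) :
    orderedDet e (Fin.cons a (Fin.cons b v)) = -orderedDet e (Fin.cons b (Fin.cons a v)) := by
  have hperm := det_permute' (Equiv.swap (0 : Fin (n + 2)) 1)
    (of fun i j => (Fin.cons b (Fin.cons a v) : Fin (n + 2) → C → ℤ) j (e.symm i))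
  rw [Equiv.Perm.sign_swap (by simp), Units.val_neg, Units.val_one, Int.cast_neg, Int.cast_one,
    neg_one_mul] at hperm
  rw [orderedDet, orderedDet, ← hperm]
  congr 1
  ext i j
  simp only [submatrix_apply, of_apply, id]
  refine Fin.cases ?_ (Fin.cases ?_ fun j => ?_) j
  · rw [Equiv.swap_apply_left]
    rfl
  · rw [Fin.succ_zero_eq_one, Equiv.swap_apply_right]
    rfl
  · rw [Equiv.swap_apply_of_ne_of_ne (Fin.succ_ne_zero _) (by simp [Fin.ext_iff])]
    rfl

/-- The list of the elements of a finite set by increasing `key`. -/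
def listByKey (e : C ≃ Fin n) (key : C → ℕ) : Fin n ≃ C :=
  (Tuple.sort (key ∘ e.symm)).trans e.symm

theorem strictMono_listByKey (e : C ≃ Fin n) {key : C → ℕ} (hkey : Function.Injective key) :
    StrictMono (key ∘ listByKey e key) :=
  (Tuple.monotone_sort (key ∘ e.symm)).strictMono_of_injective
    (hkey.comp (listByKey e key).injective)

theorem eq_listByKey (e : C ≃ Fin n) {key : C → ℕ} {f : Fin n ≃ C} (hf : StrictMono (key ∘ f)) :
    f = listByKey e key := by
  have hkey : Function.Injective key := hf.injective.of_comp_right f.surjective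
  have hrange : Set.range (key ∘ f) = Set.range (key ∘ listByKey e key) := by
    rw [EquivLike.range_comp, EquivLike.range_comp]
  have heq := (hf.range_inj (strictMono_listByKey e hkey)).1 hrange
  exact Equiv.ext fun i => hkey (congrFun heq i)

theorem orderedDet_eq_orderSign_mul (e : C ≃ Fin n) (key : C → ℕ) (v : Fin n → C → ℤ) :
    orderedDet e v = (orderSign e key : ℤ) * (of fun i j => v j (listByKey e key i)).det := by
  have hperm : (of fun i j => v j (listByKey e key i)).det =
      (orderSign e key : ℤ) * orderedDet e v :=
    det_permute (Tuple.sort (key ∘ e.symm)) (of fun i j => v j (e.symm i))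
  rw [hperm, ← mul_assoc, ← Units.val_mul, Int.units_mul_self, Units.val_one, one_mul]

open Classical in
/-- The key of a local order: `c₁` comes first, then `c₂`, then the other elements by `f`. -/
noncomputable def leadingKey (c₁ c₂ : C) (f : C → ℕ) (c : C) : ℕ :=
  if c = c₁ then 0 else if c = c₂ then 1 else 2 + f c

theorem leadingKey_left {c₁ c₂ : C} {f : C → ℕ} : leadingKey c₁ c₂ f c₁ = 0 := if_pos rfl

theorem leadingKey_right {c₁ c₂ : C} (hne : c₁ ≠ c₂) {f : C → ℕ} : leadingKey c₁ c₂ f c₂ = 1 := by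
  rw [leadingKey, if_neg hne.symm, if_pos rfl]

theorem leadingKey_of_ne {c₁ c₂ c : C} {f : C → ℕ} (h₁ : c ≠ c₁) (h₂ : c ≠ c₂) :
    leadingKey c₁ c₂ f c = 2 + f c := by
  rw [leadingKey, if_neg h₁, if_neg h₂]

theorem leadingKey_injective {c₁ c₂ : C} {f : C → ℕ} (hf : Set.InjOn f {c₁, c₂}ᶜ) :
    Function.Injective (leadingKey c₁ c₂ f) := by
  intro c d h
  unfold leadingKey at h
  split_ifs at h with h₁ h₂ h₃ h₄ h₅ h₆ h₇ h₈ <;> try omega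
  · rw [h₁, h₂]
  · rw [h₄, h₆]
  · exact hf (by simp [h₁, h₄]) (by simp [h₇, h₈]) (by omega)

theorem listByKey_leadingKey_zero (e : C ≃ Fin (n + 2)) {c₁ c₂ : C} {f : C → ℕ}
    (hf : Set.InjOn f {c₁, c₂}ᶜ) : listByKey e (leadingKey c₁ c₂ f) 0 = c₁ := by
  obtain ⟨i, hi⟩ := (listByKey e (leadingKey c₁ c₂ f)).surjective c₁
  rcases eq_zero_or_pos i with rfl | hpos
  · exact hi
  · have hlt := strictMono_listByKey e (leadingKey_injective hf) hpos
    simp only [Function.comp_apply, hi, leadingKey_left, not_lt_zero] at hlt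

theorem listByKey_leadingKey_one (e : C ≃ Fin (n + 2)) {c₁ c₂ : C} (hne : c₁ ≠ c₂) {f : C → ℕ}
    (hf : Set.InjOn f {c₁, c₂}ᶜ) : listByKey e (leadingKey c₁ c₂ f) 1 = c₂ := by
  have hmono := strictMono_listByKey e (leadingKey_injective hf)
  have hzero := listByKey_leadingKey_zero e hf
  obtain ⟨i, hi⟩ := (listByKey e (leadingKey c₁ c₂ f)).surjective c₂
  rcases lt_trichotomy i 1 with h | rfl | h
  · obtain rfl : i = 0 := (Fin.lt_one_iff i).1 h
    exact absurd (hzero.symm.trans hi) hne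
  · exact hi
  · have h₀ := hmono (show (0 : Fin (n + 2)) < 1 by simp)
    have h₁ := hmono h
    simp only [Function.comp_apply, hi, leadingKey_right hne] at h₀ h₁
    omega

theorem listByKey_of_identify (e : C ≃ Fin (n + 2)) (e' : C' ≃ Fin (n + 1)) {q : C → C'}
    {c₁ c₂ : C} (hne : c₁ ≠ c₂) (hq : q c₁ = q c₂) (hq' : ∀ c, c ≠ c₁ → c ≠ c₂ → q c ≠ q c₁)
    {f : C → ℕ} {f' : C' → ℕ} (hff' : ∀ c, c ≠ c₁ → c ≠ c₂ → f' (q c) = f c)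
    (hf : Set.InjOn f {c₁, c₂}ᶜ) (i : Fin (n + 1)) :
    listByKey e' (leadingKey (q c₁) (q c₁) f') i =
      q (listByKey e (leadingKey c₁ c₂ f) i.succ) := by
  set list := listByKey e (leadingKey c₁ c₂ f)
  have hmono := strictMono_listByKey e (leadingKey_injective hf)
  have hzero : list 0 = c₁ := listByKey_leadingKey_zero e hf
  have hone : list 1 = c₂ := listByKey_leadingKey_one e hne hf
  have hkey₀ : leadingKey (q c₁) (q c₁) f' (q (list (Fin.succ 0))) = 0 := by
    rw [Fin.succ_zero_eq_one, hone, ← hq, leadingKey_left]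
  have hkey (j : Fin n) : leadingKey (q c₁) (q c₁) f' (q (list j.succ.succ)) =
      leadingKey c₁ c₂ f (list j.succ.succ) := by
    have h₁ : list j.succ.succ ≠ c₁ := hzero ▸ list.injective.ne (Fin.succ_ne_zero _)
    have h₂ : list j.succ.succ ≠ c₂ := hone ▸ list.injective.ne (by simp [Fin.ext_iff])
    rw [leadingKey_of_ne (hq' _ h₁ h₂) (hq' _ h₁ h₂), leadingKey_of_ne h₁ h₂, hff' _ h₁ h₂]
  have hmono' : StrictMono fun i : Fin (n + 1) =>
      leadingKey (q c₁) (q c₁) f' (q (list i.succ)) := by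
    intro i j hij
    obtain ⟨j, rfl⟩ := Fin.exists_succ_eq.2 (Fin.ne_zero_of_lt hij)
    refine Fin.cases (fun _ => ?_) (fun i hij => ?_) i hij
    · have := hmono (Fin.succ_pos j.succ)
      simp only [hkey₀, hkey]
      exact (Nat.zero_le _).trans_lt this
    · simp only [hkey]
      exact hmono (Fin.succ_lt_succ_iff.2 hij)
  have hinj : Function.Injective fun i : Fin (n + 1) => q (list i.succ) :=
    hmono'.injective.of_comp (f := leadingKey (q c₁) (q c₁) f')
  have : Finite C' := .of_equiv _ e'.symm
  have hbij := hinj.bijective_of_nat_card_le (Nat.card_congr e').le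
  have heq := eq_listByKey e' (key := leadingKey (q c₁) (q c₁) f')
    (f := Equiv.ofBijective _ hbij) hmono'
  exact (DFunLike.congr_fun heq i).symm

theorem orderedDet_cons_comp (e : C ≃ Fin (n + 1)) (e' : C' ≃ Fin n) {q : C → C'} {c₁ c₂ : C}
    (hne : c₁ ≠ c₂) (hq : q c₁ = q c₂) (hq' : ∀ c, c ≠ c₁ → c ≠ c₂ → q c ≠ q c₁)
    {f : C → ℕ} {f' : C' → ℕ} (hff' : ∀ c, c ≠ c₁ → c ≠ c₂ → f' (q c) = f c)
    (hf : Set.InjOn f {c₁, c₂}ᶜ) (v₀ : C → ℤ) (v : Fin n → C' → ℤ) :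
    orderedDet e (Fin.cons v₀ fun j => v j ∘ q) =
      (orderSign e (leadingKey c₁ c₂ f) * orderSign e' (leadingKey (q c₁) (q c₁) f') : ℤˣ) *
        (v₀ c₁ - v₀ c₂) * orderedDet e' v := by
  obtain ⟨m, rfl⟩ : ∃ m, n = m + 1 := Nat.exists_eq_succ_of_ne_zero fun h => by
    subst h
    exact hne (e.injective (Subsingleton.elim (α := Fin 1) _ _))
  have hzero := listByKey_leadingKey_zero e hf
  have hone := listByKey_leadingKey_one e hne hf
  rw [orderedDet_eq_orderSign_mul e (leadingKey c₁ c₂ f), det_of_rows_eq_off_zero _ fun j => by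
      simp only [of_apply, hzero, hone, Fin.cons_succ, Function.comp_apply, hq],
    orderedDet_eq_orderSign_mul e' (leadingKey (q c₁) (q c₁) f')]
  simp only [of_apply, hzero, hone, Fin.cons_zero, listByKey_of_identify e e' hne hq hq' hff' hf]
  have hminor (A : Matrix (Fin (m + 1)) (Fin (m + 1)) ℤ) (ε δ : ℤˣ) (x : ℤ) :
      (ε : ℤ) * (x * A.det) = (ε * δ : ℤˣ) * x * (δ * A.det) := by
    have hδ : (δ : ℤ) * δ = 1 := by rw [← Units.val_mul, Int.units_mul_self, Units.val_one]
    rw [Units.val_mul]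
    linear_combination (-(ε : ℤ) * x * A.det) * hδ
  exact hminor _ _ _ _

end Determinants

namespace Diagram

/-! ### Smoothings and cycles -/

section Cycles

variable {D : Diagram} {s t : D.State} {τ : Fin D.n}

theorem smooth_smooth (s : D.State) (h : D.HalfEdge) : D.smooth s (D.smooth s h) = h := by
  obtain ⟨c, x⟩ := h
  by_cases hv : D.Vertical s c <;> cases x <;> simp [smooth, hv]

theorem smooth_ne (s : D.State) (h : D.HalfEdge) : D.smooth s h ≠ h := by
  obtain ⟨c, x⟩ := h
  by_cases hv : D.Vertical s c <;> cases x <;> simp [smooth, hv]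

theorem glue_ne (h : D.HalfEdge) : D.glue h ≠ h := fun hh =>
  iff_not_self ((congrArg (fun h : D.HalfEdge => h.2.Incoming) hh) ▸ D.glue_incoming h)

theorem exists_smooth_corners (s : D.State) (τ : Fin D.n) : ∃ y y' : Corner,
    (y = .nw ∧ y' = .se ∨ y = .se ∧ y' = .nw) ∧
      D.smooth s (τ, .sw) = (τ, y) ∧ D.smooth s (τ, .ne) = (τ, y') := by
  by_cases hv : D.Vertical s τ
  · exact ⟨.nw, .se, .inl ⟨rfl, rfl⟩, by simp [smooth, hv], by simp [smooth, hv]⟩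
  · exact ⟨.se, .nw, .inr ⟨rfl, rfl⟩, by simp [smooth, hv], by simp [smooth, hv]⟩

/-- The states `s` and `t` differ exactly at the crossing `τ`. -/
def FlipAt (τ : Fin D.n) (s t : D.State) : Prop := s τ ≠ t τ ∧ ∀ c, c ≠ τ → s c = t c

theorem FlipAt.symm (h : FlipAt τ s t) : FlipAt τ t s := ⟨h.1.symm, fun c hc => (h.2 c hc).symm⟩

theorem flipAt_update {a : Smoothing} (h : s τ ≠ a) : FlipAt τ s (Function.update s τ a) :=
  ⟨by rwa [Function.update_self], fun _ hc => (Function.update_of_ne hc _ _).symm⟩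

theorem FlipAt.vertical_iff (h : FlipAt τ s t) : D.Vertical t τ ↔ ¬D.Vertical s τ := by
  have := h.1
  unfold Vertical
  rcases hs : s τ <;> rcases ht : t τ <;> simp_all

theorem FlipAt.smooth_eq (h : FlipAt τ s t) {a : D.HalfEdge} (ha : a.1 ≠ τ) :
    D.smooth t a = D.smooth s a := by
  unfold smooth Vertical
  rw [h.2 _ ha]

theorem FlipAt.exists_corners (h : FlipAt τ s t) : ∃ y y' : Corner,
    (y = .nw ∧ y' = .se ∨ y = .se ∧ y' = .nw) ∧
      D.smooth s (τ, .sw) = (τ, y) ∧ D.smooth s (τ, .ne) = (τ, y') ∧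
      D.smooth t (τ, .sw) = (τ, y') ∧ D.smooth t (τ, .ne) = (τ, y) := by
  by_cases hv : D.Vertical s τ
  · refine ⟨.nw, .se, .inl ⟨rfl, rfl⟩, ?_⟩
    simp [smooth, hv, h.vertical_iff]
  · refine ⟨.se, .nw, .inr ⟨rfl, rfl⟩, ?_⟩
    simp [smooth, hv, h.vertical_iff]

/-- A point that lies on a cycle of every state: an end of a semi-arc, or a free loop. -/
abbrev Point (D : Diagram) : Type := D.HalfEdge ⊕ Fin D.freeLoops

/-- The cycle of the state `s` through a point. -/
def cycleThrough (s : D.State) : D.Point → D.Cycle s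
  | .inl h => D.cycleAt s h
  | .inr i => .inr i

theorem cycleThrough_surjective (s : D.State) : Function.Surjective (cycleThrough s) := by
  rintro (⟨⟨h⟩⟩ | i)
  exacts [⟨.inl h, rfl⟩, ⟨.inr i, rfl⟩]

theorem cycleAt_eq_iff {a b : D.HalfEdge} :
    D.cycleAt s a = D.cycleAt s b ↔ (Quot.mk _ a : D.Loop s) = Quot.mk _ b :=
  Sum.inl_injective.eq_iff

theorem cycleAt_smooth (s : D.State) (h : D.HalfEdge) :
    D.cycleAt s (D.smooth s h) = D.cycleAt s h :=
  congrArg Sum.inl (Quot.sound (r := D.Step s) (.inl rfl)).symm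

theorem cycleAt_glue (s : D.State) (h : D.HalfEdge) : D.cycleAt s (D.glue h) = D.cycleAt s h :=
  congrArg Sum.inl (Quot.sound (r := D.Step s) (.inr rfl)).symm

theorem rel_of_cycleAt_eq {R : D.HalfEdge → D.HalfEdge → Prop} (hR : Equivalence R)
    (hs : ∀ h, R h (D.smooth s h)) (hg : ∀ h, R h (D.glue h)) {a b : D.HalfEdge}
    (hab : D.cycleAt s a = D.cycleAt s b) : R a b := by
  have hstep (a b : D.HalfEdge) : D.Step s a b → R a b := by
    rintro (rfl | rfl)
    exacts [hs a, hg a]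
  exact hR.eqvGen_iff.1 ((Quot.eqvGen_exact (cycleAt_eq_iff.1 hab)).mono hstep)

theorem eq_of_cycleAt_eq {α : Type*} {f : D.HalfEdge → α}
    (hs : ∀ h, f (D.smooth s h) = f h) (hg : ∀ h, f (D.glue h) = f h) {a b : D.HalfEdge}
    (hab : D.cycleAt s a = D.cycleAt s b) : f a = f b :=
  rel_of_cycleAt_eq (R := fun a b => f a = f b) ⟨fun _ => rfl, Eq.symm, Eq.trans⟩
    (fun h => (hs h).symm) (fun h => (hg h).symm) hab

theorem rel_of_cycleThrough_eq {R : D.Point → D.Point → Prop} (hR : Equivalence R)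
    (hs : ∀ h, R (.inl h) (.inl (D.smooth s h))) (hg : ∀ h, R (.inl h) (.inl (D.glue h)))
    {p p' : D.Point} (hpp' : cycleThrough s p = cycleThrough s p') : R p p' := by
  rcases p with a | i <;> rcases p' with b | j
  · exact rel_of_cycleAt_eq (hR.comap Sum.inl) hs hg hpp'
  · exact (Sum.inl_ne_inr hpp').elim
  · exact (Sum.inr_ne_inl hpp').elim
  · obtain rfl : i = j := Sum.inr_injective hpp'
    exact hR.refl _

/-- The point `p` lies on a cycle of `s` through the crossing `τ`. -/
def Meets (s : D.State) (τ : Fin D.n) (p : D.Point) : Prop :=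
  cycleThrough s p = D.cycleAt s (τ, .sw) ∨ cycleThrough s p = D.cycleAt s (τ, .ne)

/-- Two different cycles of `s` pass through the crossing `τ`. -/
def Separated (s : D.State) (τ : Fin D.n) : Prop := D.cycleAt s (τ, .sw) ≠ D.cycleAt s (τ, .ne)

theorem meets_congr {p p' : D.Point} (h : cycleThrough s p = cycleThrough s p') :
    Meets s τ p ↔ Meets s τ p' := by
  rw [Meets, Meets, h]

theorem meets_corner (s : D.State) (τ : Fin D.n) (x : Corner) : Meets s τ (.inl (τ, x)) := by
  obtain ⟨y, y', hy, hsw, hne⟩ := exists_smooth_corners s τ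
  have hy₁ : Meets s τ (.inl (τ, y)) := .inl (hsw ▸ cycleAt_smooth s _)
  have hy₂ : Meets s τ (.inl (τ, y')) := .inr (hne ▸ cycleAt_smooth s _)
  rcases hy with ⟨rfl, rfl⟩ | ⟨rfl, rfl⟩ <;> cases x
  all_goals first | exact .inl rfl | exact .inr rfl | assumption

theorem Meets.cycleThrough_eq (hs : ¬Separated s τ) {p : D.Point} (hp : Meets s τ p) :
    cycleThrough s p = D.cycleAt s (τ, .sw) :=
  hp.elim id fun h => h.trans (not_not.1 hs).symm

theorem cycleAt_corner (hs : ¬Separated s τ) (x : Corner) :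
    D.cycleAt s (τ, x) = D.cycleAt s (τ, .sw) :=
  (meets_corner s τ x).cycleThrough_eq hs

namespace FlipAt

theorem cycleThrough_eq_of_not_separated (hf : FlipAt τ s t) (ht : ¬Separated t τ)
    {p p' : D.Point} (hpp' : cycleThrough s p = cycleThrough s p') :
    cycleThrough t p = cycleThrough t p' := by
  refine rel_of_cycleThrough_eq (R := fun p p' => cycleThrough t p = cycleThrough t p')
    ⟨fun _ => rfl, Eq.symm, Eq.trans⟩ ?_ (fun h => (cycleAt_glue t h).symm) hpp'
  rintro ⟨c, x⟩
  by_cases hc : c = τ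
  · subst hc
    exact (cycleAt_corner ht x).trans (cycleAt_corner ht _).symm
  · rw [← hf.smooth_eq hc]
    exact (cycleAt_smooth t _).symm

theorem cycleThrough_eq_or_meets (hf : FlipAt τ s t) {p p' : D.Point}
    (hpp' : cycleThrough t p = cycleThrough t p') :
    cycleThrough s p = cycleThrough s p' ∨ Meets s τ p ∧ Meets s τ p' := by
  refine rel_of_cycleThrough_eq
    (R := fun p p' => cycleThrough s p = cycleThrough s p' ∨ Meets s τ p ∧ Meets s τ p')
    ⟨fun _ => .inl rfl, Or.imp Eq.symm And.symm, ?_⟩ ?_ (fun h => .inl (cycleAt_glue s h).symm) hpp'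
  · rintro x y z (h | h) (h' | h')
    · exact .inl (h.trans h')
    · exact .inr ⟨(meets_congr h).2 h'.1, h'.2⟩
    · exact .inr ⟨h.1, (meets_congr h').1 h.2⟩
    · exact .inr ⟨h.1, h'.2⟩
  · rintro ⟨c, x⟩
    by_cases hc : c = τ
    · subst hc
      exact .inr ⟨meets_corner s c x, meets_corner s c _⟩
    · rw [hf.smooth_eq hc]
      exact .inl (cycleAt_smooth s _).symm

theorem meets (hf : FlipAt τ s t) {p : D.Point} (hp : Meets s τ p) : Meets t τ p := by
  rcases hp with h | h
  · rcases hf.symm.cycleThrough_eq_or_meets (p' := .inl _) h with h | h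
    exacts [.inl h, h.1]
  · rcases hf.symm.cycleThrough_eq_or_meets (p' := .inl _) h with h | h
    exacts [.inr h, h.1]

theorem meets_iff (hf : FlipAt τ s t) {p : D.Point} : Meets t τ p ↔ Meets s τ p :=
  ⟨hf.symm.meets, hf.meets⟩

theorem cycleThrough_eq_of_not_meets (hf : FlipAt τ s t) {p p' : D.Point} (hp : ¬Meets s τ p)
    (hpp' : cycleThrough s p = cycleThrough s p') : cycleThrough t p = cycleThrough t p' :=
  (hf.symm.cycleThrough_eq_or_meets hpp').resolve_right fun h => hp (hf.symm.meets h.1)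

end FlipAt

end Cycles

/-! ### Directions of cycles -/

section Orientations

variable {D : Diagram} {s t : D.State} {τ : Fin D.n} {o o' : D.HalfEdge → ℤˣ}

/-- A choice of directions of the cycles of `s`: a sign at every half-edge that changes along every
arc and every semi-arc. -/
structure IsOrientation (s : D.State) (o : D.HalfEdge → ℤˣ) : Prop where
  smooth : ∀ h, o (D.smooth s h) = -o h
  glue : ∀ h, o (D.glue h) = -o h

/-- The smoothing arcs of `s` as a permutation of the half-edges. -/
noncomputable def smoothPerm (s : D.State) : Equiv.Perm D.HalfEdge :=
  Function.Involutive.toPerm (D.smooth s) (smooth_smooth s)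

/-- The semi-arcs as a permutation of the half-edges. -/
def gluePerm (D : Diagram) : Equiv.Perm D.HalfEdge := Function.Involutive.toPerm D.glue D.glue_glue

theorem smoothPerm_mul_self (s : D.State) : smoothPerm s * smoothPerm s = 1 :=
  Equiv.ext (smooth_smooth s)

theorem gluePerm_mul_self (D : Diagram) : gluePerm D * gluePerm D = 1 := Equiv.ext D.glue_glue

/-- The permutation that moves every half-edge by two steps along its cycle. -/
noncomputable def advance (s : D.State) : Equiv.Perm D.HalfEdge := smoothPerm s * gluePerm D

theorem advance_apply (s : D.State) (h : D.HalfEdge) :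
    advance s h = D.smooth s (D.glue h) := rfl

theorem exists_isOrientation (s : D.State) : ∃ o : D.HalfEdge → ℤˣ, IsOrientation s o := by
  obtain ⟨o, hs, hg⟩ := exists_sign_alternating (smoothPerm_mul_self s) (gluePerm_mul_self D)
    (smooth_ne s) glue_ne
  exact ⟨o, hs, hg⟩

theorem IsOrientation.mul_eq (ho : IsOrientation s o) (ho' : IsOrientation s o')
    {a b : D.HalfEdge} (h : D.cycleAt s a = D.cycleAt s b) : o a * o' a = o b * o' b :=
  eq_of_cycleAt_eq (f := fun a => o a * o' a)
    (fun h => by rw [ho.smooth, ho'.smooth, neg_mul_neg])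
    (fun h => by rw [ho.glue, ho'.glue, neg_mul_neg]) h

theorem IsOrientation.advance_apply (ho : IsOrientation s o) (h : D.HalfEdge) :
    o (advance s h) = o h := by
  rw [Diagram.advance_apply, ho.smooth, ho.glue, neg_neg]

theorem sameCycle_or_sameCycle_glue {a b : D.HalfEdge} (h : D.cycleAt s a = D.cycleAt s b) :
    (advance s).SameCycle a b ∨ (advance s).SameCycle a (D.glue b) := by
  have hglue {x y : D.HalfEdge} (h : (advance s).SameCycle x y) :
      (advance s).SameCycle (D.glue x) (D.glue y) :=
    sameCycle_mul_apply_apply (smoothPerm_mul_self s) (gluePerm_mul_self D) h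
  have hglue' {x y : D.HalfEdge} (h : (advance s).SameCycle x (D.glue y)) :
      (advance s).SameCycle (D.glue x) y := D.glue_glue y ▸ hglue h
  refine rel_of_cycleAt_eq (R := fun a b =>
    (advance s).SameCycle a b ∨ (advance s).SameCycle a (D.glue b)) ⟨?_, ?_, ?_⟩ ?_ ?_ h
  · exact fun x => .inl (.refl _ _)
  · exact Or.imp Equiv.Perm.SameCycle.symm fun h => (hglue' h).symm
  · rintro x y z (h | h) (h' | h')
    · exact .inl (h.trans h')
    · exact .inr (h.trans h')
    · exact .inr (h.trans (hglue h'))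
    · exact .inl (h.trans (hglue' h'))
  · exact fun x => .inr (.symm ⟨1, by
      rw [zpow_one, advance_apply, D.glue_glue, smooth_smooth]⟩)
  · exact fun x => .inr (by rw [D.glue_glue])

theorem eq_of_sameCycle_advance {α : Type*} {f : D.HalfEdge → α}
    (hf : ∀ h, f (advance s h) = f h) {a b : D.HalfEdge} (h : (advance s).SameCycle a b) :
    f a = f b := by
  obtain ⟨i, -, rfl⟩ := h.exists_pow_eq'
  induction i with
  | zero => rfl
  | succ i ih => rw [pow_succ', Equiv.Perm.mul_apply, hf, ← ih ⟨i, rfl⟩]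

theorem IsOrientation.sameCycle_advance_iff (ho : IsOrientation s o) {a b : D.HalfEdge}
    (hab : o a = o b) : (advance s).SameCycle a b ↔ D.cycleAt s a = D.cycleAt s b := by
  refine ⟨eq_of_sameCycle_advance fun h => ?_, fun h => ?_⟩
  · rw [Diagram.advance_apply, cycleAt_smooth, cycleAt_glue]
  · refine (sameCycle_or_sameCycle_glue h).resolve_right fun h' => ?_
    have := eq_of_sameCycle_advance ho.advance_apply h'
    rw [ho.glue, hab] at this
    exact units_ne_neg_self _ this

/-- If the cycles of `s` pass `τ` in the source-sink direction, they also orient `t`. -/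
theorem IsOrientation.flip (ho : IsOrientation s o) (hf : FlipAt τ s t)
    (h : o (τ, .sw) = o (τ, .ne)) : IsOrientation t o := by
  refine ⟨fun a => ?_, ho.glue⟩
  by_cases ha : a.1 = τ
  · obtain ⟨c, x⟩ := a
    obtain rfl : c = τ := ha
    obtain ⟨y, y', hy, s₁, s₂, t₁, t₂⟩ := hf.exists_corners
    have a₁ := ho.smooth (c, .sw)
    have a₂ := ho.smooth (c, .ne)
    have t₃ : D.smooth t (c, y') = (c, .sw) := by rw [← t₁, smooth_smooth]
    have t₄ : D.smooth t (c, y) = (c, .ne) := by rw [← t₂, smooth_smooth]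
    rw [s₁] at a₁
    rw [s₂] at a₂
    rcases hy with ⟨rfl, rfl⟩ | ⟨rfl, rfl⟩ <;> cases x <;> simp_all
  · rw [hf.smooth_eq ha, ho.smooth]

/-- The permutation by which `advance s` moves the half-edges of sign `ε`. -/
noncomputable def IsOrientation.advanceOn (ho : IsOrientation s o) (ε : ℤˣ) :
    Equiv.Perm {h : D.HalfEdge // o h = ε} :=
  (advance s).subtypePerm fun h => by rw [ho.advance_apply]

/-- Among the half-edges with the sign of `sw` and `ne`, only the arcs ending at `sw` and `ne`
change, and their ends are exchanged. -/
theorem IsOrientation.advanceOn_flip [DecidableEq D.HalfEdge] (ho : IsOrientation s o)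
    (ho' : IsOrientation t o) (hf : FlipAt τ s t) {ε : ℤˣ} (hsw : o (τ, .sw) = ε)
    (hne : o (τ, .ne) = ε) :
    ho'.advanceOn ε = Equiv.swap ⟨(τ, .sw), hsw⟩ ⟨(τ, .ne), hne⟩ * ho.advanceOn ε := by
  refine Equiv.ext fun ⟨z, hz⟩ => ?_
  have hgz : o (D.glue z) = -ε := by rw [ho.glue, hz]
  have hadv {r : D.State} (hr : IsOrientation r o) :
      hr.advanceOn ε ⟨z, hz⟩ = ⟨D.smooth r (D.glue z), by rw [hr.smooth, hgz, neg_neg]⟩ := rfl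
  rw [Equiv.Perm.mul_apply, hadv, hadv]
  by_cases hc : (D.glue z).1 = τ
  · obtain ⟨y, y', hy, s₁, s₂, t₁, t₂⟩ := hf.exists_corners
    have hx : D.glue z = (τ, y) ∨ D.glue z = (τ, y') := by
      generalize D.glue z = w at hc hgz ⊢
      obtain ⟨c, x⟩ := w
      obtain rfl : c = τ := hc
      have _hε : ε ≠ -ε := units_ne_neg_self ε
      rcases hy with ⟨rfl, rfl⟩ | ⟨rfl, rfl⟩ <;> cases x <;> simp_all
    rcases hx with hx | hx
    · have hs : D.smooth s (D.glue z) = (τ, .sw) := by rw [hx, ← s₁, smooth_smooth]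
      have ht : D.smooth t (D.glue z) = (τ, .ne) := by rw [hx, ← t₂, smooth_smooth]
      simp only [hs, ht, Equiv.swap_apply_left]
    · have hs : D.smooth s (D.glue z) = (τ, .ne) := by rw [hx, ← s₂, smooth_smooth]
      have ht : D.smooth t (D.glue z) = (τ, .sw) := by rw [hx, ← t₁, smooth_smooth]
      simp only [hs, ht, Equiv.swap_apply_right]
  · have hne' (x : Corner) : D.smooth s (D.glue z) ≠ (τ, x) := fun h =>
      hc (congrArg Prod.fst h)
    simp only [hf.smooth_eq hc]
    rw [Equiv.swap_apply_of_ne_of_ne] <;> exact fun h => hne' _ (congrArg Subtype.val h)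

theorem FlipAt.separated_iff_of_isOrientation (hf : FlipAt τ s t) (ho : IsOrientation s o)
    (h : o (τ, .sw) = o (τ, .ne)) : Separated t τ ↔ ¬Separated s τ := by
  classical
  have ho' := ho.flip hf h
  have hiff {r : D.State} (hr : IsOrientation r o) :
      (hr.advanceOn (o (τ, .ne))).SameCycle ⟨(τ, .sw), h⟩ ⟨(τ, .ne), rfl⟩ ↔ ¬Separated r τ := by
    rw [IsOrientation.advanceOn, Equiv.Perm.sameCycle_subtypePerm, hr.sameCycle_advance_iff h,
      Separated, not_not]
  have hst := hiff ho'
  rw [ho.advanceOn_flip ho' hf h rfl, sameCycle_swap_mul_iff _ (by simp), hiff ho] at hst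
  exact not_iff_not.1 hst.symm

theorem exists_isOrientation_of_separated (hs : Separated s τ) :
    ∃ o : D.HalfEdge → ℤˣ, IsOrientation s o ∧ o (τ, .sw) = 1 ∧ o (τ, .ne) = 1 := by
  classical
  obtain ⟨o, ho⟩ := exists_isOrientation s
  refine ⟨fun h => o h * if D.cycleAt s h = D.cycleAt s (τ, .sw) then o (τ, .sw) else o (τ, .ne),
    ⟨fun h => ?_, fun h => ?_⟩, ?_, ?_⟩
  · simp only [cycleAt_smooth, ho.smooth, neg_mul]
  · simp only [cycleAt_glue, ho.glue, neg_mul]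
  · dsimp only
    rw [if_pos rfl, Int.units_mul_self]
  · dsimp only
    rw [if_neg (Ne.symm hs), Int.units_mul_self]

theorem FlipAt.not_separated (hf : FlipAt τ s t) (hs : Separated s τ) : ¬Separated t τ := by
  obtain ⟨o, ho, hsw, hne⟩ := exists_isOrientation_of_separated hs
  rw [hf.separated_iff_of_isOrientation ho (hsw.trans hne.symm)]
  exact not_not.2 hs

theorem FlipAt.separated_iff (hf : FlipAt τ s t) (ho : IsOrientation s o) :
    Separated t τ ↔ ¬Separated s τ ∧ o (τ, .sw) = o (τ, .ne) := by
  refine ⟨fun ht => ⟨hf.symm.not_separated ht, ?_⟩, fun h =>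
    (hf.separated_iff_of_isOrientation ho h.2).2 h.1⟩
  obtain ⟨o', ho', hsw, hne⟩ := exists_isOrientation_of_separated ht
  have := ho.mul_eq (ho'.flip hf.symm (hsw.trans hne.symm)) (not_not.1 (hf.symm.not_separated ht))
  rwa [hsw, hne, mul_one, mul_one] at this

end Orientations

end Diagram

/-! ### Cut loci and marked points -/

open Classical in
/-- The source-sink orientation at a corner, as a sign: `1` if it points into the crossing. -/
noncomputable def Convention.inSign (κ : Convention) (x : Corner) : ℤˣ :=
  if κ.PointsIn x then 1 else -1

theorem Convention.inSign_ne (κ : Convention) : κ.inSign .ne = κ.inSign .sw := rfl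

theorem Convention.inSign_nw (κ : Convention) : κ.inSign .nw = -κ.inSign .sw := by
  rcases h : κ.risingIn <;> simp [inSign, PointsIn, h]

theorem Convention.inSign_se (κ : Convention) : κ.inSign .se = -κ.inSign .sw := κ.inSign_nw

namespace Diagram

section Transport

variable {D : Diagram} {κ : Convention} {s t : D.State} {τ : Fin D.n} {o : D.HalfEdge → ℤˣ}

theorem inSign_smooth (κ : Convention) (s : D.State) (h : D.HalfEdge) :
    κ.inSign (D.smooth s h).2 = -κ.inSign h.2 := by
  obtain ⟨c, x⟩ := h
  by_cases hv : D.Vertical s c <;> cases x <;>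
    simp [smooth, hv, κ.inSign_nw, κ.inSign_ne, κ.inSign_se]

open Classical in
theorem inSign_glue (κ : Convention) (h : D.HalfEdge) :
    κ.inSign (D.glue h).2 = -(-1) ^ (if D.Cut κ h then 1 else 0) * κ.inSign h.2 := by
  unfold Convention.inSign Cut
  by_cases h₁ : κ.PointsIn h.2 <;> by_cases h₂ : κ.PointsIn (D.glue h).2 <;> simp [h₁, h₂]

/-- The source-sink orientation at `h` compared with the direction `o` of its cycle. It changes
exactly at the cut loci. -/
noncomputable def align (κ : Convention) (o : D.HalfEdge → ℤˣ) (h : D.HalfEdge) : ℤˣ :=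
  κ.inSign h.2 * o h

namespace IsOrientation

theorem align_smooth (ho : IsOrientation s o) (h : D.HalfEdge) :
    align κ o (D.smooth s h) = align κ o h := by
  rw [align, inSign_smooth, ho.smooth, neg_mul_neg, align]

open Classical in
theorem align_glue (ho : IsOrientation s o) (h : D.HalfEdge) :
    align κ o (D.glue h) = align κ o h * (-1) ^ (if D.Cut κ h then 1 else 0) := by
  rw [align, inSign_glue, ho.glue, neg_mul, neg_mul_neg, mul_assoc, mul_comm, align]

theorem align_corner (ho : IsOrientation s o) (h : o (τ, .sw) = o (τ, .ne)) (x : Corner) :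
    align κ o (τ, x) = align κ o (τ, .sw) := by
  obtain ⟨y, y', hy, hsw, hne⟩ := exists_smooth_corners s τ
  have ha : align κ o (τ, .ne) = align κ o (τ, .sw) := by rw [align, align, h, κ.inSign_ne]
  have hy₁ : align κ o (τ, y) = align κ o (τ, .sw) := hsw ▸ ho.align_smooth _
  have hy₂ : align κ o (τ, y') = align κ o (τ, .sw) := (hne ▸ ho.align_smooth _).trans ha
  rcases hy with ⟨rfl, rfl⟩ | ⟨rfl, rfl⟩ <;> cases x
  all_goals first | rfl | assumption

end IsOrientation

theorem CutPath.neg_one_pow {a b : D.HalfEdge} {m : ℕ} (h : D.CutPath κ s a b m)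
    (ho : IsOrientation s o) : (-1 : ℤˣ) ^ m = align κ o a * align κ o b := by
  induction h with
  | refl => rw [Int.units_mul_self, pow_zero]
  | smooth _ ih => rw [ih, ho.align_smooth]
  | glue _ ih => rw [pow_add, ih, ho.align_glue, mul_assoc]

theorem CutPath.trans {a b c : D.HalfEdge} {m n : ℕ} (h : D.CutPath κ s a b m)
    (h' : D.CutPath κ s b c n) : D.CutPath κ s a c (m + n) := by
  induction h' with
  | refl => exact h
  | smooth _ ih => exact ih.smooth
  | glue _ ih => exact add_assoc m _ _ ▸ ih.glue

theorem CutPath.symm {a b : D.HalfEdge} {m : ℕ} (h : D.CutPath κ s a b m) :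
    ∃ m', D.CutPath κ s b a m' := by
  induction h with
  | refl => exact ⟨0, .refl _⟩
  | @smooth b _ _ ih =>
    obtain ⟨m', ih⟩ := ih
    exact ⟨_, (smooth_smooth s b ▸ (CutPath.refl (D.smooth s b)).smooth).trans ih⟩
  | @glue b _ _ ih =>
    obtain ⟨m', ih⟩ := ih
    exact ⟨_, (D.glue_glue b ▸ (CutPath.refl (κ := κ) (s := s) (D.glue b)).glue).trans ih⟩

theorem exists_cutPath (κ : Convention) {a b : D.HalfEdge} (h : D.cycleAt s a = D.cycleAt s b) :
    ∃ m, D.CutPath κ s a b m :=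
  rel_of_cycleAt_eq (R := fun a b => ∃ m, D.CutPath κ s a b m)
    ⟨fun a => ⟨0, .refl a⟩, fun ⟨_, h⟩ => h.symm, fun ⟨_, h⟩ ⟨_, h'⟩ => ⟨_, h.trans h'⟩⟩
    (fun a => ⟨_, (CutPath.refl a).smooth⟩) (fun a => ⟨_, (CutPath.refl a).glue⟩) h

theorem IsOrientation.neg_one_pow_cutCount (ho : IsOrientation s o) {a b : D.HalfEdge}
    (h : D.cycleAt s a = D.cycleAt s b) :
    (-1 : ℤˣ) ^ D.cutCount κ s a b = align κ o a * align κ o b :=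
  (Nat.sInf_mem (exists_cutPath κ h)).neg_one_pow ho

theorem FlipAt.exists_isOrientation (hf : FlipAt τ s t) (h : Separated s τ ∨ Separated t τ) :
    ∃ o : D.HalfEdge → ℤˣ, IsOrientation s o ∧ IsOrientation t o ∧ o (τ, .sw) = o (τ, .ne) := by
  rcases h with h | h
  · obtain ⟨o, ho, hsw, hne⟩ := exists_isOrientation_of_separated h
    exact ⟨o, ho, ho.flip hf (hsw.trans hne.symm), hsw.trans hne.symm⟩
  · obtain ⟨o, ho, hsw, hne⟩ := exists_isOrientation_of_separated h
    exact ⟨o, ho.flip hf.symm (hsw.trans hne.symm), ho, hsw.trans hne.symm⟩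

/-- The sign `1` if the arc labelled `1` of the smoothing of `τ` ends at the corner `sw`. -/
noncomputable def arcSign (κ : Convention) (s : D.State) (τ : Fin D.n) : ℤˣ :=
  open Classical in
  if D.Vertical s τ then (if κ.leftFirst then 1 else -1) else (if κ.topFirst then -1 else 1)

theorem arcSign_congr (κ : Convention) (h : s τ = t τ) : arcSign κ s τ = arcSign κ t τ := by
  unfold arcSign Vertical
  rw [h]

theorem FlipAt.arcSign_mul (hf : FlipAt τ s t) {τ' : Fin D.n} {s' t' : D.State}
    (hf' : FlipAt τ' s' t') :
    arcSign κ s τ * arcSign κ t τ = arcSign κ s' τ' * arcSign κ t' τ' := by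
  have a := hf.vertical_iff
  have b := hf'.vertical_iff
  unfold arcSign
  by_cases h : D.Vertical s τ <;> by_cases h' : D.Vertical s' τ' <;> simp [a, b, h, h', mul_comm]

theorem arc_cases (κ : Convention) (τ : Fin D.n) {α : Type*} {f : D.HalfEdge → α}
    (hf : ∀ h, f (D.smooth s h) = f h) :
    arcSign κ s τ = 1 ∧ f (D.arc₁ κ s τ) = f (τ, .sw) ∧ f (D.arc₂ κ s τ) = f (τ, .ne) ∨
      arcSign κ s τ = -1 ∧ f (D.arc₁ κ s τ) = f (τ, .ne) ∧ f (D.arc₂ κ s τ) = f (τ, .sw) := by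
  have hne := hf (τ, .ne)
  by_cases hv : D.Vertical s τ
  · simp only [smooth, hv, if_true] at hne
    rcases hl : κ.leftFirst <;> simp [arcSign, arc₁, arc₂, hv, hl, hne]
  · simp only [smooth, hv, if_false] at hne
    rcases hl : κ.topFirst <;> simp [arcSign, arc₁, arc₂, hv, hl, hne]

theorem cycle₁_ne_cycle₂_iff (κ : Convention) :
    D.cycle₁ κ s τ ≠ D.cycle₂ κ s τ ↔ Separated s τ := by
  unfold cycle₁ cycle₂ Separated
  rcases arc_cases κ τ (cycleAt_smooth s) with ⟨-, h₁, h₂⟩ | ⟨-, h₁, h₂⟩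
  · rw [h₁, h₂]
  · rw [h₁, h₂, ne_comm]

theorem meets_iff_eq_cycle₁_or_eq_cycle₂ (κ : Convention) {p : D.Point} : Meets s τ p ↔
    cycleThrough s p = D.cycle₁ κ s τ ∨ cycleThrough s p = D.cycle₂ κ s τ := by
  unfold cycle₁ cycle₂ Meets
  rcases arc_cases κ τ (cycleAt_smooth s) with ⟨-, h₁, h₂⟩ | ⟨-, h₁, h₂⟩
  · rw [h₁, h₂]
  · rw [h₁, h₂, or_comm]

theorem not_meets_iff (κ : Convention) {p : D.Point} : ¬Meets s τ p ↔
    cycleThrough s p ≠ D.cycle₁ κ s τ ∧ cycleThrough s p ≠ D.cycle₂ κ s τ := by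
  rw [meets_iff_eq_cycle₁_or_eq_cycle₂ κ, not_or]

theorem Meets.cycleThrough_eq_cycle₁ (hs : ¬Separated s τ) {p : D.Point} (hp : Meets s τ p) :
    cycleThrough s p = D.cycle₁ κ s τ :=
  (hp.cycleThrough_eq hs).trans (cycleAt_corner hs _).symm

theorem not_meets_inr (s : D.State) (τ : Fin D.n) (i : Fin D.freeLoops) :
    ¬Meets s τ (.inr i) := by
  rintro (h | h) <;> exact Sum.inr_ne_inl h

namespace GlobalChoice

variable (g : D.GlobalChoice)

theorem cycleAt_star (s : D.State) (q : D.Loop s) : D.cycleAt s (g.star s q) = Sum.inl q :=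
  congrArg Sum.inl (g.star_mem s q)

/-- The sign by which the bar operations on a path to the marked point of its cycle multiply the
generator `X`. -/
noncomputable def transport (κ : Convention) (s : D.State) : D.Point → ℤˣ
  | .inl h => (-1) ^ g.barsTo κ s h
  | .inr _ => 1

theorem transport_inl (ho : IsOrientation s o) (h : D.HalfEdge) :
    g.transport κ s (.inl h) = align κ o h * align κ o (g.star s (Quot.mk _ h)) :=
  ho.neg_one_pow_cutCount (g.cycleAt_star s _).symm

theorem transport_mul (ho : IsOrientation s o) {a b : D.HalfEdge}
    (h : D.cycleAt s a = D.cycleAt s b) :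
    g.transport κ s (.inl a) * g.transport κ s (.inl b) = align κ o a * align κ o b := by
  rw [g.transport_inl ho, g.transport_inl ho, cycleAt_eq_iff.1 h, mul_mul_mul_comm,
    Int.units_mul_self, mul_one]

theorem transport_smooth (κ : Convention) (s : D.State) (h : D.HalfEdge) :
    g.transport κ s (.inl (D.smooth s h)) = g.transport κ s (.inl h) := by
  obtain ⟨o, ho⟩ := exists_isOrientation s
  have := g.transport_mul (κ := κ) ho (cycleAt_smooth s h)
  rwa [ho.align_smooth, Int.units_mul_self, mul_eq_one_iff_eq_inv, Int.units_inv_eq_self] at this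

theorem neg_one_pow_preBars_mul_transport (ho : IsOrientation s o) (hτ : o (τ, .sw) = o (τ, .ne))
    {h : D.HalfEdge} (hm : Meets s τ (.inl h)) :
    (-1) ^ g.preBars κ s τ (D.cycleAt s h) * g.transport κ s (.inl h) =
      align κ o h * align κ o (τ, .sw) := by
  have key {x : Corner} (hx : D.cycleAt s h = D.cycleAt s (τ, x)) :
      (-1) ^ g.barsTo κ s (τ, x) * g.transport κ s (.inl h) = align κ o h * align κ o (τ, .sw) := by
    rw [mul_comm, ← ho.align_corner hτ x]
    exact g.transport_mul ho hx
  unfold preBars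
  split_ifs with h₁ h₂
  · exact key h₁
  · exact key h₂
  · exact (((meets_iff_eq_cycle₁_or_eq_cycle₂ κ).1 hm).elim h₁ h₂).elim

theorem preBars_of_not_meets {p : D.Point} (hp : ¬Meets s τ p) :
    g.preBars κ s τ (cycleThrough s p) = 0 := by
  obtain ⟨h₁, h₂⟩ := (not_meets_iff κ).1 hp
  rw [preBars, if_neg h₁, if_neg h₂]

theorem postBars_of_meets {p : D.Point} (hp : Meets t τ p) :
    g.postBars κ s t τ (cycleThrough t p) = g.preBars κ t τ (cycleThrough t p) := by
  rw [postBars.eq_def, preBars]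
  split_ifs with h₁ h₂
  · rfl
  · rfl
  · exact (((meets_iff_eq_cycle₁_or_eq_cycle₂ κ).1 hp).elim h₁ h₂).elim

theorem postBars_mul_transport_of_not_meets (hf : FlipAt τ s t) (hs : IsOrientation s o)
    (ht : IsOrientation t o) {h : D.HalfEdge} (hm : ¬Meets s τ (.inl h)) :
    (-1) ^ g.postBars κ s t τ (D.cycleAt t h) * g.transport κ t (.inl h) =
      g.transport κ s (.inl h) := by
  obtain ⟨h₁, h₂⟩ : D.cycleAt t h ≠ D.cycle₁ κ t τ ∧ D.cycleAt t h ≠ D.cycle₂ κ t τ :=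
    (not_meets_iff κ).1 (hf.meets_iff.not.2 hm)
  have hstar : (Quot.mk _ (g.star t (Quot.mk _ h)) : D.Loop s) = Quot.mk _ h :=
    cycleAt_eq_iff.1 (hf.symm.cycleThrough_eq_of_not_meets (p := .inl h) (p' := .inl _)
      (hf.meets_iff.not.2 hm) (g.cycleAt_star t _).symm).symm
  have hstar' : D.cycleAt t (g.star s (Quot.mk _ h)) = D.cycleAt t h :=
    (hf.cycleThrough_eq_of_not_meets (p := .inl h) (p' := .inl _) hm (g.cycleAt_star s _).symm).symm
  rw [postBars.eq_def, if_neg h₁, if_neg h₂]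
  change g.transport κ t (.inl (g.star s (Quot.mk _ (g.star t (Quot.mk _ h))))) * _ = _
  rw [hstar, g.transport_mul ht hstar', g.transport_inl hs, mul_comm]

theorem preBars_mul_transport (hf : FlipAt τ s t) (hd : Separated s τ ∨ Separated t τ)
    (p : D.Point) : (-1) ^ g.preBars κ s τ (cycleThrough s p) * g.transport κ s p =
      (-1) ^ g.postBars κ s t τ (cycleThrough t p) * g.transport κ t p := by
  rcases p with h | i
  · obtain ⟨o, hs, ht, hτ⟩ := hf.exists_isOrientation hd
    by_cases hm : Meets s τ (.inl h)
    · rw [g.postBars_of_meets (hf.meets hm)]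
      exact (g.neg_one_pow_preBars_mul_transport hs hτ hm).trans
        (g.neg_one_pow_preBars_mul_transport ht hτ (hf.meets hm)).symm
    · rw [g.preBars_of_not_meets hm, pow_zero, one_mul]
      exact (g.postBars_mul_transport_of_not_meets hf hs ht hm).symm
  · have hpost : g.postBars κ s t τ (cycleThrough t (.inr i)) = 0 := by
      obtain ⟨h₁, h₂⟩ := (not_meets_iff κ).1 (not_meets_inr t τ i)
      rw [postBars.eq_def, if_neg h₁, if_neg h₂]
      rfl
    rw [g.preBars_of_not_meets (not_meets_inr s τ i), hpost]
    rfl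

end GlobalChoice

end Transport

end Diagram

/-! ### Linearity over the operators `X` -/

section Labels

variable (k : Type*) [CommRing k] (a b c : Label)

theorem mulCoeff_X_left : (if a = .one then mulCoeff k .X b c else 0) =
    if c = .X then mulCoeff k a b .one else 0 := by
  cases a <;> cases b <;> cases c <;> simp [mulCoeff]

theorem mulCoeff_X_right : (if b = .one then mulCoeff k a .X c else 0) =
    if c = .X then mulCoeff k a b .one else 0 := by
  cases a <;> cases b <;> cases c <;> simp [mulCoeff]

theorem comulCoeff_X_left : (if a = .one then comulCoeff k .X b c else 0) =
    if b = .X then comulCoeff k a .one c else 0 := by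
  cases a <;> cases b <;> cases c <;> simp [comulCoeff]

theorem comulCoeff_X_right : (if a = .one then comulCoeff k .X b c else 0) =
    if c = .X then comulCoeff k a b .one else 0 := by
  cases a <;> cases b <;> cases c <;> simp [comulCoeff]

theorem mulCoeff_one_one : mulCoeff k .one .one c = if c = .one then 1 else 0 := by
  cases c <;> simp [mulCoeff]

theorem comulCoeff_one : comulCoeff k .one b c =
    (if b = .X ∧ c = .one then 1 else 0) + if c = .X ∧ b = .one then 1 else 0 := by
  cases b <;> cases c <;> simp [comulCoeff]

end Labels

namespace Diagram

variable {D : Diagram} {κ : Convention} {s t : D.State} {τ : Fin D.n}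

section AgreeOff

variable {l : D.EnhancedState s} {m : D.EnhancedState t} {p p' : D.Point}

theorem agreeOff_iff : AgreeOff κ τ l m ↔
    ∀ p, ¬Meets s τ p → m (cycleThrough t p) = l (cycleThrough s p) := by
  refine ⟨fun h p hp => ?_, fun h => ⟨fun a h₁ h₂ => h (.inl a) ((not_meets_iff κ).2 ⟨h₁, h₂⟩),
    fun i => h (.inr i) (not_meets_inr s τ i)⟩⟩
  obtain ⟨h₁, h₂⟩ := (not_meets_iff κ).1 hp
  rcases p with a | i
  exacts [h.1 a h₁ h₂, h.2 i]

theorem FlipAt.cycleThrough_eq_iff_of_not_meets (hf : FlipAt τ s t) (hp : ¬Meets s τ p) :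
    cycleThrough t p = cycleThrough t p' ↔ cycleThrough s p = cycleThrough s p' :=
  ⟨hf.symm.cycleThrough_eq_of_not_meets (hf.meets_iff.not.2 hp),
    hf.cycleThrough_eq_of_not_meets hp⟩

variable {a : Label}

theorem agreeOff_update_left_of_meets [DecidableEq (D.Cycle s)]
    (hp : Meets s τ p) :
    AgreeOff κ τ (Function.update l (cycleThrough s p) a) m ↔ AgreeOff κ τ l m := by
  rw [agreeOff_iff, agreeOff_iff]
  refine forall₂_congr fun p' hp' => ?_
  rw [Function.update_of_ne fun h => hp' ((meets_congr h).2 hp)]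

theorem agreeOff_update_right_of_meets [DecidableEq (D.Cycle t)]
    (hf : FlipAt τ s t) (hp : Meets s τ p) :
    AgreeOff κ τ l (Function.update m (cycleThrough t p) a) ↔ AgreeOff κ τ l m := by
  rw [agreeOff_iff, agreeOff_iff]
  refine forall₂_congr fun p' hp' => ?_
  rw [Function.update_of_ne fun h =>
    hp' (hf.meets_iff.1 ((meets_congr h).2 (hf.meets hp)))]

theorem agreeOff_update_left_of_not_meets [DecidableEq (D.Cycle s)]
    (hf : FlipAt τ s t) (hp : ¬Meets s τ p) :
    AgreeOff κ τ (Function.update l (cycleThrough s p) a) m ↔ m (cycleThrough t p) = a ∧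
      ∀ p', ¬Meets s τ p' → cycleThrough s p' ≠ cycleThrough s p →
        m (cycleThrough t p') = l (cycleThrough s p') := by
  rw [agreeOff_iff]
  refine ⟨fun h => ⟨by simpa using h p hp, fun p' hp' e => ?_⟩, fun h p' hp' => ?_⟩
  · rw [h p' hp', Function.update_of_ne e]
  · by_cases e : cycleThrough s p' = cycleThrough s p
    · rw [e, Function.update_self, (hf.cycleThrough_eq_iff_of_not_meets hp').2 e, h.1]
    · rw [Function.update_of_ne e, h.2 p' hp' e]

theorem agreeOff_update_right_of_not_meets [DecidableEq (D.Cycle t)]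
    (hf : FlipAt τ s t) (hp : ¬Meets s τ p) :
    AgreeOff κ τ l (Function.update m (cycleThrough t p) a) ↔ l (cycleThrough s p) = a ∧
      ∀ p', ¬Meets s τ p' → cycleThrough s p' ≠ cycleThrough s p →
        m (cycleThrough t p') = l (cycleThrough s p') := by
  rw [agreeOff_iff]
  refine ⟨fun h => ⟨by simpa using (h p hp).symm, fun p' hp' e => ?_⟩, fun h p' hp' => ?_⟩
  · rw [← h p' hp', Function.update_of_ne ((hf.cycleThrough_eq_iff_of_not_meets hp').not.2 e)]
  · by_cases e : cycleThrough s p' = cycleThrough s p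
    · rw [(hf.cycleThrough_eq_iff_of_not_meets hp').2 e, Function.update_self, e, h.1]
    · rw [Function.update_of_ne ((hf.cycleThrough_eq_iff_of_not_meets hp').not.2 e), h.2 p' hp' e]

end AgreeOff

section Operators

variable (k : Type*) [CommRing k]

open Classical in
/-- Multiplication by `X` in the tensor factor of the cycle `c`. -/
noncomputable def mulX (c : D.Cycle s) : D.Chain k s →ₗ[k] D.Chain k s :=
  Finsupp.linearCombination k fun l : D.EnhancedState s =>
    if l c = .one then Finsupp.single (Function.update l c .X) 1 else 0

open Classical in
theorem mulX_single (c : D.Cycle s) (l : D.EnhancedState s) : mulX k c (Finsupp.single l 1) =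
    if l c = .one then Finsupp.single (Function.update l c .X) 1 else 0 := by
  rw [mulX, Finsupp.linearCombination_single, one_smul]

open Classical in
theorem mulX_apply (c : D.Cycle s) (x : D.Chain k s) (m : D.EnhancedState s) :
    mulX k c x m = if m c = .X then x (Function.update m c .one) else 0 := by
  induction x using Finsupp.induction_linear with
  | zero => simp
  | add x y hx hy => rw [map_add, Finsupp.add_apply, hx, hy]; split_ifs <;> simp
  | single l a =>
    have hiff : l c = .one ∧ Function.update l c .X = m ↔
        m c = .X ∧ l = Function.update m c .one := by
      rw [Function.update_eq_iff, Function.eq_update_iff]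
      simp only [eq_comm, and_left_comm]
    rw [mulX, Finsupp.linearCombination_single, smul_ite, smul_zero, Finsupp.smul_single,
      smul_eq_mul, mul_one, Finsupp.single_apply, ← ite_and, ← if_congr hiff rfl rfl, ite_and]
    split_ifs <;> simp [*]

theorem barMap_apply (f : D.Cycle s → ℕ) (x : D.Chain k s) (m : D.EnhancedState s) :
    barMap k f x m = (∏ c, barCoeff k (m c) ^ f c) * x m := by
  induction x using Finsupp.induction_linear with
  | zero => simp
  | add x y hx hy => rw [map_add, Finsupp.add_apply, hx, hy, Finsupp.add_apply, mul_add]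
  | single l a =>
    rw [barMap, Finsupp.linearCombination_single, Finsupp.smul_apply]
    by_cases h : l = m
    · subst h; simp [mul_comm]
    · simp [h]

theorem barMap_mulX (f : D.Cycle s → ℕ) (c : D.Cycle s) (x : D.Chain k s) :
    barMap k f (mulX k c x) = (((-1) ^ f c : ℤˣ) : ℤ) • mulX k c (barMap k f x) := by
  classical
  ext m
  rw [Finsupp.smul_apply, barMap_apply, mulX_apply, mulX_apply, barMap_apply]
  split_ifs with h
  · have hprod : ∏ d, barCoeff k (m d) ^ f d =
        (-1) ^ f c * ∏ d, barCoeff k (Function.update m c Label.one d) ^ f d := by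
      rw [← Finset.mul_prod_erase _ _ (Finset.mem_univ c),
        ← Finset.mul_prod_erase _ (fun d => barCoeff k (Function.update m c .one d) ^ f d)
          (Finset.mem_univ c), Function.update_self, h]
      simp only [barCoeff, one_pow, one_mul]
      congr 1
      refine Finset.prod_congr rfl fun d hd => ?_
      rw [Function.update_of_ne (Finset.ne_of_mem_erase hd)]
    simp [hprod, zsmul_eq_mul, mul_assoc]
  · simp

theorem siteMap_single_apply (l : D.EnhancedState s) (m : D.EnhancedState t) :
    siteMap k κ s t τ (Finsupp.single l 1) m = siteCoeff k κ τ l m := by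
  classical
  rw [siteMap, Finsupp.linearCombination_single, one_smul, Finsupp.finsetSum_apply]
  simp [Finsupp.single_apply]

open Classical in
theorem siteCoeff_of_merge (hs : Separated s τ) (l : D.EnhancedState s) (m : D.EnhancedState t) :
    siteCoeff k κ τ l m = if AgreeOff κ τ l m then
      mulCoeff k (l (D.cycle₁ κ s τ)) (l (D.cycle₂ κ s τ)) (m (D.cycle₁ κ t τ)) else 0 := by
  rw [siteCoeff, if_pos ((cycle₁_ne_cycle₂_iff κ).2 hs)]

open Classical in
theorem siteCoeff_of_split (hf : FlipAt τ s t) (ht : Separated t τ) (l : D.EnhancedState s)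
    (m : D.EnhancedState t) : siteCoeff k κ τ l m = if AgreeOff κ τ l m then
      comulCoeff k (l (D.cycle₁ κ s τ)) (m (D.cycle₁ κ t τ)) (m (D.cycle₂ κ t τ)) else 0 := by
  rw [siteCoeff, if_neg ((cycle₁_ne_cycle₂_iff κ).not.2 (hf.symm.not_separated ht)),
    if_pos ((cycle₁_ne_cycle₂_iff κ).2 ht)]

theorem siteCoeff_eq_zero (hs : ¬Separated s τ) (ht : ¬Separated t τ) (l : D.EnhancedState s)
    (m : D.EnhancedState t) : siteCoeff k κ τ l m = 0 := by
  rw [siteCoeff, if_neg ((cycle₁_ne_cycle₂_iff κ).not.2 hs),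
    if_neg ((cycle₁_ne_cycle₂_iff κ).not.2 ht), ite_self]

open Classical in
theorem siteCoeff_update_of_meets (hf : FlipAt τ s t) {p : D.Point} (hp : Meets s τ p)
    (l : D.EnhancedState s) (m : D.EnhancedState t) :
    (if l (cycleThrough s p) = .one then
        siteCoeff k κ τ (Function.update l (cycleThrough s p) .X) m else 0) =
      if m (cycleThrough t p) = .X then
        siteCoeff k κ τ l (Function.update m (cycleThrough t p) .one) else 0 := by
  by_cases hs : Separated s τ
  · simp only [siteCoeff_of_merge k hs, agreeOff_update_left_of_meets hp,
      agreeOff_update_right_of_meets hf hp]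
    by_cases ha : AgreeOff κ τ l m
    · simp only [ha, if_true]
      have hc := (cycle₁_ne_cycle₂_iff κ).2 hs
      rw [(hf.meets hp).cycleThrough_eq_cycle₁ (κ := κ) (hf.not_separated hs),
        Function.update_self]
      rcases (meets_iff_eq_cycle₁_or_eq_cycle₂ κ).1 hp with h | h
      · rw [h, Function.update_self, Function.update_of_ne hc.symm, mulCoeff_X_left]
      · rw [h, Function.update_self, Function.update_of_ne hc, mulCoeff_X_right]
    · simp [ha]
  by_cases ht : Separated t τ
  · simp only [siteCoeff_of_split k hf ht, agreeOff_update_left_of_meets hp,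
      agreeOff_update_right_of_meets hf hp]
    by_cases ha : AgreeOff κ τ l m
    · simp only [ha, if_true]
      have hc := (cycle₁_ne_cycle₂_iff κ).2 ht
      rw [hp.cycleThrough_eq_cycle₁ (κ := κ) hs, Function.update_self]
      rcases (meets_iff_eq_cycle₁_or_eq_cycle₂ κ).1 (hf.meets hp) with h | h
      · rw [h, Function.update_self, Function.update_of_ne hc.symm, comulCoeff_X_left]
      · rw [h, Function.update_self, Function.update_of_ne hc, comulCoeff_X_right]
    · simp [ha]
  · simp [siteCoeff_eq_zero k hs ht]

open Classical in
theorem siteCoeff_update_of_not_meets (hf : FlipAt τ s t) {p : D.Point} (hp : ¬Meets s τ p)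
    (l : D.EnhancedState s) (m : D.EnhancedState t) :
    (if l (cycleThrough s p) = .one then
        siteCoeff k κ τ (Function.update l (cycleThrough s p) .X) m else 0) =
      if m (cycleThrough t p) = .X then
        siteCoeff k κ τ l (Function.update m (cycleThrough t p) .one) else 0 := by
  have hagree : (l (cycleThrough s p) = .one ∧
        AgreeOff κ τ (Function.update l (cycleThrough s p) .X) m) ↔
      (m (cycleThrough t p) = .X ∧
        AgreeOff κ τ l (Function.update m (cycleThrough t p) .one)) := by
    rw [agreeOff_update_left_of_not_meets hf hp, agreeOff_update_right_of_not_meets hf hp,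
      and_left_comm]
  obtain ⟨hs₁, hs₂⟩ := (not_meets_iff κ).1 hp
  obtain ⟨ht₁, ht₂⟩ := (not_meets_iff κ).1 (hf.meets_iff.not.2 hp)
  unfold siteCoeff
  rw [Function.update_of_ne hs₁.symm, Function.update_of_ne hs₂.symm,
    Function.update_of_ne ht₁.symm, Function.update_of_ne ht₂.symm, ← ite_and, ← ite_and]
  simp only [hagree]

theorem siteMap_mulX (hf : FlipAt τ s t) (p : D.Point) (x : D.Chain k s) :
    siteMap k κ s t τ (mulX k (cycleThrough s p) x) =
      mulX k (cycleThrough t p) (siteMap k κ s t τ x) := by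
  classical
  suffices siteMap k κ s t τ ∘ₗ mulX k (cycleThrough s p) =
      mulX k (cycleThrough t p) ∘ₗ siteMap k κ s t τ from LinearMap.congr_fun this x
  refine Finsupp.lhom_ext' fun l => LinearMap.ext_ring (Finsupp.ext fun m => ?_)
  simp only [LinearMap.comp_apply, Finsupp.lsingle_apply, mulX_single, mulX_apply,
    siteMap_single_apply]
  by_cases hp : Meets s τ p
  · rw [← siteCoeff_update_of_meets k hf hp]
    split_ifs <;> simp [siteMap_single_apply]
  · rw [← siteCoeff_update_of_not_meets k hf hp]
    split_ifs <;> simp [siteMap_single_apply]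

theorem siteMap_eq_zero (hs : ¬Separated s τ) (ht : ¬Separated t τ) :
    siteMap k κ s t τ = 0 := by
  refine Finsupp.lhom_ext' fun l => LinearMap.ext_ring (Finsupp.ext fun m => ?_)
  simp only [LinearMap.comp_apply, Finsupp.lsingle_apply]
  rw [siteMap_single_apply, siteCoeff_eq_zero k hs ht]
  rfl

/-- The generator of `C(s)` in which every cycle carries the label `1`. -/
noncomputable def unit (s : D.State) : D.Chain k s := Finsupp.single (fun _ => .one) 1

open Classical in
theorem unit_apply (m : D.EnhancedState s) :
    unit k s m = if ∀ c, m c = .one then 1 else 0 := by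
  simp only [unit, Finsupp.single_apply, eq_comm (b := m), funext_iff]

open Classical in
theorem mulX_unit_apply (c : D.Cycle s) (m : D.EnhancedState s) :
    mulX k c (unit k s) m = if m c = .X ∧ ∀ d, d ≠ c → m d = .one then 1 else 0 := by
  rw [mulX_apply, unit_apply, ite_and]
  refine if_congr Iff.rfl (if_congr ⟨fun h d hd => ?_, fun h d => ?_⟩ rfl rfl) rfl
  · simpa [hd] using h d
  · rw [Function.update_apply]
    split_ifs with hd
    exacts [rfl, h d hd]

theorem barMap_unit (f : D.Cycle s → ℕ) : barMap k f (unit k s) = unit k s := by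
  simp [barMap, unit, Finsupp.linearCombination_single, barCoeff]

theorem agreeOff_one_iff (hf : FlipAt τ s t) {m : D.EnhancedState t} :
    AgreeOff κ τ (fun _ : D.Cycle s => .one) m ↔
      ∀ c, c ≠ D.cycle₁ κ t τ → c ≠ D.cycle₂ κ t τ → m c = .one := by
  rw [agreeOff_iff, (cycleThrough_surjective t).forall]
  refine forall_congr' fun p => ?_
  rw [← hf.meets_iff, not_meets_iff κ, and_imp]

theorem siteMap_unit_of_merge (hf : FlipAt τ s t) (hs : Separated s τ) :
    siteMap k κ s t τ (unit k s) = unit k t := by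
  classical
  ext m
  have hc := not_not.1 ((cycle₁_ne_cycle₂_iff κ).not.2 (hf.not_separated hs))
  have hiff : AgreeOff κ τ (fun _ : D.Cycle s => .one) m ∧ m (D.cycle₁ κ t τ) = .one ↔
      ∀ c, m c = .one := by
    rw [agreeOff_one_iff hf, ← hc]
    refine ⟨fun h c => ?_, fun h => ⟨fun c _ _ => h c, h _⟩⟩
    by_cases hc' : c = D.cycle₁ κ t τ
    exacts [hc' ▸ h.2, h.1 c hc' hc']
  simp only [unit_apply, ← hiff, ite_and]
  rw [unit, siteMap_single_apply, siteCoeff_of_merge k hs, mulCoeff_one_one]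

theorem siteMap_unit_of_split (hf : FlipAt τ s t) (ht : Separated t τ) :
    siteMap k κ s t τ (unit k s) =
      mulX k (D.cycle₁ κ t τ) (unit k t) + mulX k (D.cycle₂ κ t τ) (unit k t) := by
  classical
  ext m
  have hc := (cycle₁_ne_cycle₂_iff κ).2 ht
  have hiff {c c' : D.Cycle t} (hc : c' ≠ c) : (∀ d, d ≠ c → m d = .one) ↔
      (∀ d, d ≠ c → d ≠ c' → m d = .one) ∧ m c' = .one :=
    ⟨fun h => ⟨fun d hd _ => h d hd, h c' hc⟩, fun h d hd =>
      if e : d = c' then e ▸ h.2 else h.1 d hd e⟩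
  have hcomm : (∀ d, d ≠ D.cycle₂ κ t τ → d ≠ D.cycle₁ κ t τ → m d = .one) ↔
      AgreeOff κ τ (fun _ : D.Cycle s => .one) m := by
    rw [agreeOff_one_iff hf]
    exact forall_congr' fun d => forall_comm
  simp only [Finsupp.add_apply, mulX_unit_apply, hiff hc, hiff hc.symm, hcomm,
    ← agreeOff_one_iff hf (κ := κ)]
  rw [unit, siteMap_single_apply, siteCoeff_of_split k hf ht, comulCoeff_one]
  by_cases ha : AgreeOff κ τ (fun _ : D.Cycle s => .one) m <;> simp only [ha, if_true, true_and,
    if_false, false_and, and_false, add_zero]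

end Operators

namespace GlobalChoice

variable (k : Type*) [CommRing k] (g : D.GlobalChoice)

/-- Multiplication by `X` in the factor of the cycle through `p`, transported from `p` to the marked
point of this cycle. -/
noncomputable def opX (κ : Convention) (s : D.State) (p : D.Point) :
    D.Chain k s →ₗ[k] D.Chain k s :=
  (g.transport κ s p : ℤ) • mulX k (cycleThrough s p)

theorem opX_smooth (κ : Convention) (s : D.State) (h : D.HalfEdge) :
    g.opX k κ s (.inl (D.smooth s h)) = g.opX k κ s (.inl h) := by
  rw [opX, g.transport_smooth]
  exact congrArg (fun c => (_ : ℤ) • mulX k c) (cycleAt_smooth s h)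

theorem mulX_cycleThrough (κ : Convention) (s : D.State) (p : D.Point) :
    mulX k (cycleThrough s p) = (g.transport κ s p : ℤ) • g.opX k κ s p := by
  rw [opX, smul_smul, ← Units.val_mul, Int.units_mul_self, Units.val_one, one_smul]

theorem opX_comm (p p' : D.Point) (x : D.Chain k s) :
    g.opX k κ s p (g.opX k κ s p' x) = g.opX k κ s p' (g.opX k κ s p x) := by
  classical
  simp only [opX, LinearMap.smul_apply, map_zsmul]
  rw [smul_comm]
  congr 2
  ext m
  simp only [mulX_apply]
  by_cases h : cycleThrough s p = cycleThrough s p'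
  · rw [h]
  · rw [Function.update_of_ne h, Function.update_of_ne (Ne.symm h), Function.update_comm h]
    split_ifs <;> rfl

/-- The sum of the operators `opX` of the two arcs at `τ`. -/
noncomputable def sumX (κ : Convention) (s : D.State) (τ : Fin D.n) :
    D.Chain k s →ₗ[k] D.Chain k s :=
  g.opX k κ s (.inl (τ, .sw)) + g.opX k κ s (.inl (τ, .ne))

theorem sumX_comm (τ τ' : Fin D.n) (x : D.Chain k s) :
    g.sumX k κ s τ (g.sumX k κ s τ' x) = g.sumX k κ s τ' (g.sumX k κ s τ x) := by
  simp only [sumX, LinearMap.add_apply, map_add]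
  rw [add_add_add_comm, g.opX_comm k (.inl (τ, .sw)), g.opX_comm k (.inl (τ, .sw)),
    g.opX_comm k (.inl (τ, .ne)), g.opX_comm k (.inl (τ, .ne))]

/-- The sign of an edge of the cube: the product of the signs of its two local-to-global
permutations. -/
noncomputable def edgeSign (κ : Convention) (s t : D.State) (τ : Fin D.n) : ℤˣ :=
  orderSign (g.order t) (g.postKey κ s t τ) * orderSign (g.order s) (g.preKey κ s τ)

theorem partialDiff_apply (x : D.Chain k s) : g.partialDiff k κ s t τ x =
    (g.edgeSign κ s t τ : ℤ) • barMap k (g.postBars κ s t τ)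
      (siteMap k κ s t τ (barMap k (g.preBars κ s τ) x)) := rfl

theorem partialDiff_eq_zero (hs : ¬Separated s τ) (ht : ¬Separated t τ) :
    g.partialDiff k κ s t τ = 0 := by
  refine LinearMap.ext fun x => ?_
  rw [partialDiff_apply, siteMap_eq_zero k hs ht, LinearMap.zero_apply, map_zero, smul_zero,
    LinearMap.zero_apply]

theorem partialDiff_opX (hf : FlipAt τ s t) (p : D.Point) (x : D.Chain k s) :
    g.partialDiff k κ s t τ (g.opX k κ s p x) = g.opX k κ t p (g.partialDiff k κ s t τ x) := by
  by_cases hd : Separated s τ ∨ Separated t τ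
  · have htransport : g.transport κ t p = (-1) ^ g.postBars κ s t τ (cycleThrough t p) *
        ((-1) ^ g.preBars κ s τ (cycleThrough s p) * g.transport κ s p) := by
      rw [g.preBars_mul_transport hf hd, ← mul_assoc, Int.units_mul_self, one_mul]
    simp only [partialDiff_apply, opX, LinearMap.smul_apply, map_zsmul, barMap_mulX,
      siteMap_mulX k hf, smul_smul, htransport, Units.val_mul]
    congr 1
    ring
  · rw [not_or] at hd
    rw [g.partialDiff_eq_zero k hd.1 hd.2, LinearMap.zero_apply, LinearMap.zero_apply, map_zero]

theorem partialDiff_sumX (hf : FlipAt τ s t) (τ' : Fin D.n) (x : D.Chain k s) :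
    g.partialDiff k κ s t τ (g.sumX k κ s τ' x) =
      g.sumX k κ t τ' (g.partialDiff k κ s t τ x) := by
  simp only [sumX, LinearMap.add_apply, map_add, g.partialDiff_opX k hf]

theorem partialDiff_unit_of_merge (hf : FlipAt τ s t) (hs : Separated s τ) :
    g.partialDiff k κ s t τ (unit k s) = (g.edgeSign κ s t τ : ℤ) • unit k t := by
  rw [partialDiff_apply, barMap_unit, siteMap_unit_of_merge k hf hs, barMap_unit]

theorem partialDiff_unit_of_split (hf : FlipAt τ s t) (ht : Separated t τ) :
    g.partialDiff k κ s t τ (unit k s) =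
      (g.edgeSign κ s t τ : ℤ) • g.sumX k κ t τ (unit k t) := by
  have hc := (cycle₁_ne_cycle₂_iff κ).2 ht
  have h₁ : g.postBars κ s t τ (D.cycle₁ κ t τ) = g.barsTo κ t (D.arc₁ κ t τ) := by
    rw [postBars.eq_def, if_pos rfl]
  have h₂ : g.postBars κ s t τ (D.cycle₂ κ t τ) = g.barsTo κ t (D.arc₂ κ t τ) := by
    rw [postBars.eq_def, if_neg hc.symm, if_pos rfl]
  rw [partialDiff_apply, barMap_unit, siteMap_unit_of_split k hf ht, map_add, barMap_mulX,
    barMap_mulX, barMap_unit, h₁, h₂]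
  change _ • (g.opX k κ t (.inl (D.arc₁ κ t τ)) (unit k t) +
    g.opX k κ t (.inl (D.arc₂ κ t τ)) (unit k t)) = _
  rcases arc_cases κ τ (f := fun h => g.opX k κ t (.inl h)) (g.opX_smooth k κ t) with
    ⟨-, h₁, h₂⟩ | ⟨-, h₁, h₂⟩
  · rw [h₁, h₂, sumX, LinearMap.add_apply]
  · rw [h₁, h₂, add_comm, sumX, LinearMap.add_apply]

theorem ext_unit {F G : D.Chain k s →ₗ[k] D.Chain k t}
    (hF : ∀ p x, F (g.opX k κ s p x) = g.opX k κ t p (F x))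
    (hG : ∀ p x, G (g.opX k κ s p x) = g.opX k κ t p (G x))
    (h : F (unit k s) = G (unit k s)) : F = G := by
  classical
  suffices ∀ S : Finset (D.Cycle s),
      F (Finsupp.single (fun c => if c ∈ S then .X else .one) 1) =
        G (Finsupp.single (fun c => if c ∈ S then .X else .one) 1) by
    refine Finsupp.lhom_ext' fun l => LinearMap.ext_ring ?_
    have hl : l = fun c => if c ∈ Finset.univ.filter (l · = .X) then .X else .one := by
      funext c
      cases hc : l c <;> simp [hc]
    rw [hl]
    exact this _
  intro S
  induction S using Finset.induction_on with
  | empty => simpa only [unit, Finset.notMem_empty, if_false] using h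
  | insert c S hc ih =>
    have hX : (Finsupp.single (fun d => if d ∈ insert c S then .X else .one) 1 : D.Chain k s) =
        mulX k c (Finsupp.single (fun d => if d ∈ S then .X else .one) 1) := by
      rw [mulX_single, if_pos (if_neg hc)]
      congr 1
      funext d
      rw [Function.update_apply]
      by_cases hd : d = c <;> simp [hd]
    obtain ⟨p, rfl⟩ := cycleThrough_surjective s c
    rw [hX, g.mulX_cycleThrough k κ, LinearMap.smul_apply, map_zsmul, map_zsmul, hF, hG, ih]

end GlobalChoice

end Diagram

theorem orderSign_trans_finCongr {α : Type*} {n m : ℕ} (e : α ≃ Fin n) (h : n = m)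
    (key : α → ℕ) : orderSign (e.trans (finCongr h)) key = orderSign e key := by
  subst h
  rfl

theorem Corner.sum_eq {M : Type*} [AddCommMonoid M] (f : Corner → M) :
    ∑ x, f x = f .sw + (f .se + (f .ne + f .nw)) := by
  have huniv : (Finset.univ : Finset Corner) = {.sw, .se, .ne, .nw} := rfl
  rw [huniv, Finset.sum_insert (by decide), Finset.sum_insert (by decide),
    Finset.sum_insert (by decide), Finset.sum_singleton]

namespace Diagram

/-! ### Signs of merges -/

section Signs

variable {D : Diagram} {κ : Convention} {s t P Q : D.State} {τ : Fin D.n}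
  {v : D.Point → ℤ}

/-- The function `v` on the points of the diagram is constant on the cycles of `s`. -/
def ConstOnCycles (s : D.State) (v : D.Point → ℤ) : Prop :=
  ∀ p p', cycleThrough s p = cycleThrough s p' → v p = v p'

/-- The difference of the values of `v` at the corners `sw` and `ne` of the crossing `τ`. -/
def cornerDiff (τ : Fin D.n) (v : D.Point → ℤ) : ℤ := v (.inl (τ, .sw)) - v (.inl (τ, .ne))

namespace ConstOnCycles

theorem smooth (hv : ConstOnCycles s v) (h : D.HalfEdge) :
    v (.inl (D.smooth s h)) = v (.inl h) := hv _ _ (cycleAt_smooth s h)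

theorem glue (hv : ConstOnCycles s v) (h : D.HalfEdge) :
    v (.inl (D.glue h)) = v (.inl h) := hv _ _ (cycleAt_glue s h)

theorem cornerDiff_eq_zero (hv : ConstOnCycles s v) (hs : ¬Separated s τ) :
    cornerDiff τ v = 0 := sub_eq_zero.2 (hv _ _ (not_not.1 hs))

theorem flip (hv : ConstOnCycles s v) (hf : FlipAt τ s t) (h : cornerDiff τ v = 0) :
    ConstOnCycles t v := by
  have hmeets {p : D.Point} (hp : Meets s τ p) : v p = v (.inl (τ, .sw)) :=
    hp.elim (hv _ (.inl _)) fun h' => (hv _ (.inl _) h').trans (sub_eq_zero.1 h).symm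
  intro p p' hpp'
  rcases hf.cycleThrough_eq_or_meets hpp' with h' | ⟨hp, hp'⟩
  exacts [hv _ _ h', (hmeets hp).trans (hmeets hp').symm]

theorem of_merge (hv : ConstOnCycles t v) (hf : FlipAt τ s t) (hs : Separated s τ) :
    ConstOnCycles s v := hv.flip hf.symm (hv.cornerDiff_eq_zero (hf.not_separated hs))

theorem arc_sub_arc (hv : ConstOnCycles s v) :
    v (.inl (D.arc₁ κ s τ)) - v (.inl (D.arc₂ κ s τ)) = arcSign κ s τ * cornerDiff τ v := by
  rcases arc_cases κ τ (f := fun h => v (.inl h)) hv.smooth with ⟨h, h₁, h₂⟩ | ⟨h, h₁, h₂⟩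
  · rw [h, h₁, h₂, Units.val_one, one_mul, cornerDiff]
  · rw [h, h₁, h₂, Units.val_neg, Units.val_one, neg_one_mul, cornerDiff, neg_sub]

end ConstOnCycles

open Classical in
/-- The indicator function of a cycle of `s`. -/
noncomputable def indicator (c : D.Cycle s) (p : D.Point) : ℤ :=
  if cycleThrough s p = c then 1 else 0

theorem constOnCycles_indicator (c : D.Cycle s) : ConstOnCycles s (indicator c) := fun p p' h => by
  rw [indicator, indicator, h]

theorem cornerDiff_indicator (hs : Separated s τ) :
    cornerDiff τ (indicator (D.cycleAt s (τ, .sw))) = 1 := by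
  have hne : cycleThrough s (.inl (τ, .ne)) ≠ D.cycleAt s (τ, .sw) := Ne.symm hs
  rw [cornerDiff, indicator, indicator, if_neg hne, sub_zero]
  exact if_pos rfl

namespace GlobalChoice

variable (g : D.GlobalChoice)

/-- A point on each cycle: the marked point, except on a free loop. -/
def basePoint (s : D.State) : D.Cycle s → D.Point
  | .inl q => .inl (g.star s q)
  | .inr i => .inr i

theorem cycleThrough_basePoint (s : D.State) (c : D.Cycle s) :
    cycleThrough s (g.basePoint s c) = c := by
  rcases c with q | i
  exacts [g.cycleAt_star s q, rfl]

theorem carry_eq (s t : D.State) (c : D.Cycle t) :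
    g.carry s t c = cycleThrough s (g.basePoint t c) := by
  rcases c with q | i <;> rfl

theorem carry_cycleThrough (hf : FlipAt τ P Q) (hQ : ¬Separated Q τ) (p : D.Point) :
    g.carry Q P (cycleThrough P p) = cycleThrough Q p := by
  rw [carry_eq]
  exact hf.cycleThrough_eq_of_not_separated hQ (g.cycleThrough_basePoint P _)

theorem carry_cycleThrough_of_not_meets (hf : FlipAt τ s t) {p : D.Point} (hp : ¬Meets t τ p) :
    g.carry s t (cycleThrough t p) = cycleThrough s p := by
  rw [carry_eq]
  exact (hf.symm.cycleThrough_eq_of_not_meets hp (g.cycleThrough_basePoint t _).symm).symm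

theorem carry_surjective (hf : FlipAt τ P Q) (hQ : ¬Separated Q τ) :
    Function.Surjective (g.carry Q P) := fun c => by
  obtain ⟨p, rfl⟩ := cycleThrough_surjective Q c
  exact ⟨_, g.carry_cycleThrough hf hQ p⟩

theorem carry_cycle₁ (hf : FlipAt τ P Q) (hQ : ¬Separated Q τ) :
    g.carry Q P (D.cycle₁ κ P τ) = D.cycle₁ κ Q τ :=
  (g.carry_cycleThrough hf hQ (.inl _)).trans
    ((meets_corner Q τ _).cycleThrough_eq_cycle₁ (κ := κ) hQ)

theorem carry_cycle₂ (hf : FlipAt τ P Q) (hQ : ¬Separated Q τ) :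
    g.carry Q P (D.cycle₂ κ P τ) = D.cycle₁ κ Q τ :=
  (g.carry_cycleThrough hf hQ (.inl _)).trans
    ((meets_corner Q τ _).cycleThrough_eq_cycle₁ (κ := κ) hQ)

theorem carry_injOn (hf : FlipAt τ P Q) (hQ : ¬Separated Q τ) :
    Set.InjOn (g.carry Q P) {D.cycle₂ κ P τ}ᶜ := by
  intro c hc d hd h
  obtain ⟨p, rfl⟩ := cycleThrough_surjective P c
  obtain ⟨p', rfl⟩ := cycleThrough_surjective P d
  rw [g.carry_cycleThrough hf hQ, g.carry_cycleThrough hf hQ] at h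
  refine (hf.cycleThrough_eq_or_meets h).elim id fun hm => ?_
  rw [meets_iff_eq_cycle₁_or_eq_cycle₂ κ, meets_iff_eq_cycle₁_or_eq_cycle₂ κ] at hm
  rw [hm.1.resolve_right hc, hm.2.resolve_right hd]

theorem carry_ne_cycle₁ (hf : FlipAt τ P Q) (hP : Separated P τ) {c : D.Cycle P}
    (h₁ : c ≠ D.cycle₁ κ P τ) (h₂ : c ≠ D.cycle₂ κ P τ) : g.carry Q P c ≠ D.cycle₁ κ Q τ := by
  have hQ := hf.not_separated hP
  rw [← g.carry_cycle₁ hf hQ]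
  exact (g.carry_injOn hf hQ).ne h₂ ((cycle₁_ne_cycle₂_iff κ).2 hP) h₁

end GlobalChoice

theorem GlobalChoice.nonempty (D : Diagram) : Nonempty D.GlobalChoice :=
  ⟨⟨fun _ => Quot.out, fun _ => Quot.out_eq, fun _ => Fintype.equivFin _⟩⟩

theorem FlipAt.card_of_merge (hf : FlipAt τ P Q) (hP : Separated P τ) :
    Fintype.card (D.Cycle P) = Fintype.card (D.Cycle Q) + 1 := by
  classical
  have κ : Convention := ⟨true, true, true⟩
  obtain ⟨g⟩ := GlobalChoice.nonempty D
  have hQ := hf.not_separated hP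
  have hbij : Function.Bijective
      fun c : {c : D.Cycle P // c ≠ D.cycle₂ κ P τ} => g.carry Q P c := by
    refine ⟨(g.carry_injOn hf hQ).injective, fun c => ?_⟩
    obtain ⟨d, rfl⟩ := g.carry_surjective hf hQ c
    by_cases hd : d = D.cycle₂ κ P τ
    · subst hd
      exact ⟨⟨_, (cycle₁_ne_cycle₂_iff κ).2 hP⟩,
        (g.carry_cycle₁ hf hQ).trans (g.carry_cycle₂ hf hQ).symm⟩
    · exact ⟨⟨d, hd⟩, rfl⟩
  rw [← Fintype.card_congr (Equiv.optionSubtypeNe (D.cycle₂ κ P τ)), Fintype.card_option,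
    Fintype.card_of_bijective hbij]

theorem FlipAt.card_of_not_separated (hf : FlipAt τ s t) (hs : ¬Separated s τ)
    (ht : ¬Separated t τ) : Fintype.card (D.Cycle s) = Fintype.card (D.Cycle t) := by
  obtain ⟨g⟩ := GlobalChoice.nonempty D
  exact (Fintype.card_le_of_surjective _ (g.carry_surjective hf.symm hs)).antisymm
    (Fintype.card_le_of_surjective _ (g.carry_surjective hf ht))

namespace GlobalChoice

variable (g : D.GlobalChoice)

/-- The determinant of the values of the functions `v` on the cycles of `s` in their global
order. -/
noncomputable def cycleDet (s : D.State) {n : ℕ} (hn : Fintype.card (D.Cycle s) = n)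
    (v : Fin n → D.Point → ℤ) : ℤ :=
  orderedDet ((g.order s).trans (finCongr hn)) fun j c => v j (g.basePoint s c)

theorem cycleDet_swap {n : ℕ} (hn : Fintype.card (D.Cycle s) = n + 2) (a b : D.Point → ℤ)
    (v : Fin n → D.Point → ℤ) :
    g.cycleDet s hn (Fin.cons a (Fin.cons b v)) = -g.cycleDet s hn (Fin.cons b (Fin.cons a v)) := by
  have hcons (a b : D.Point → ℤ) :
      (fun j c => (Fin.cons a (Fin.cons b v) : Fin (n + 2) → D.Point → ℤ) j (g.basePoint s c)) =
        Fin.cons (a ∘ g.basePoint s) (Fin.cons (b ∘ g.basePoint s)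
          fun j => v j ∘ g.basePoint s) := by
    funext j
    refine Fin.cases rfl (Fin.cases rfl fun j => rfl) j
  rw [cycleDet, cycleDet, hcons, hcons, orderedDet_swap]

theorem exists_cycleDet_eq_one (s : D.State) {n : ℕ} (hn : Fintype.card (D.Cycle s) = n) :
    ∃ v : Fin n → D.Point → ℤ, (∀ j, ConstOnCycles s (v j)) ∧ g.cycleDet s hn v = 1 := by
  classical
  refine ⟨fun j => indicator (((g.order s).trans (finCongr hn)).symm j),
    fun j => constOnCycles_indicator _, ?_⟩
  rw [cycleDet, orderedDet, ← Matrix.det_one (n := Fin n) (R := ℤ)]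
  congr 1
  ext i j
  simp only [Matrix.of_apply, indicator, g.cycleThrough_basePoint, Matrix.one_apply,
    EmbeddingLike.apply_eq_iff_eq]

/-- Two cycles of `P` merge at `τ` into one cycle of `Q`, and `ε` is the sign by which the merge
changes the global orders of the cycles, if the cycle of `P` through the arc labelled `1` is placed
before the one through the arc labelled `2`. -/
def IsMergeSign (κ : Convention) (P Q : D.State) (τ : Fin D.n) (ε : ℤˣ) : Prop :=
  ∀ (n : ℕ) (hP : Fintype.card (D.Cycle P) = n + 1) (hQ : Fintype.card (D.Cycle Q) = n)
    (v₀ : D.Point → ℤ) (v : Fin n → D.Point → ℤ), ConstOnCycles P v₀ →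
    (∀ j, ConstOnCycles Q (v j)) →
    g.cycleDet P hP (Fin.cons v₀ v) =
      (ε * arcSign κ P τ : ℤˣ) * cornerDiff τ v₀ * g.cycleDet Q hQ v

theorem isMergeSign_of_leadingKey (hf : FlipAt τ P Q) (hP : Separated P τ) {f : D.Cycle P → ℕ}
    {f' : D.Cycle Q → ℕ} (hinj : Set.InjOn f {D.cycle₁ κ P τ, D.cycle₂ κ P τ}ᶜ)
    (hff' : ∀ c, c ≠ D.cycle₁ κ P τ → c ≠ D.cycle₂ κ P τ → f' (g.carry Q P c) = f c) :
    g.IsMergeSign κ P Q τ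
      (orderSign (g.order P) (leadingKey (D.cycle₁ κ P τ) (D.cycle₂ κ P τ) f) *
        orderSign (g.order Q) (leadingKey (D.cycle₁ κ Q τ) (D.cycle₂ κ Q τ) f')) := by
  intro n hnP hnQ v₀ v hv₀ hv
  have hQ := hf.not_separated hP
  have hQ₁₂ : D.cycle₂ κ Q τ = D.cycle₁ κ Q τ :=
    (not_not.1 ((cycle₁_ne_cycle₂_iff κ).not.2 hQ)).symm
  have hcons : (fun j c => (Fin.cons v₀ v : Fin (n + 1) → D.Point → ℤ) j (g.basePoint P c)) =
      Fin.cons (v₀ ∘ g.basePoint P) fun j => (v j ∘ g.basePoint Q) ∘ g.carry Q P := by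
    funext j
    refine Fin.cases rfl (fun j => funext fun c => hv j _ _ ?_) j
    rw [g.cycleThrough_basePoint, g.carry_eq]
  have hdet := orderedDet_cons_comp ((g.order P).trans (finCongr hnP))
    ((g.order Q).trans (finCongr hnQ)) ((cycle₁_ne_cycle₂_iff κ).2 hP)
    ((g.carry_cycle₁ hf hQ).trans (g.carry_cycle₂ hf hQ).symm)
    (fun c h₁ h₂ => g.carry_cycle₁ (κ := κ) hf hQ ▸ g.carry_ne_cycle₁ hf hP h₁ h₂)
    hff' hinj (v₀ ∘ g.basePoint P) fun j => v j ∘ g.basePoint Q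
  have harc : (v₀ ∘ g.basePoint P) (D.cycle₁ κ P τ) - (v₀ ∘ g.basePoint P) (D.cycle₂ κ P τ) =
      arcSign κ P τ * cornerDiff τ v₀ := by
    rw [← hv₀.arc_sub_arc]
    exact congrArg₂ _ (hv₀ _ _ (g.cycleThrough_basePoint P _))
      (hv₀ _ _ (g.cycleThrough_basePoint P _))
  rw [harc, orderSign_trans_finCongr, orderSign_trans_finCongr, g.carry_cycle₁ hf hQ] at hdet
  rw [cycleDet, hcons, hdet, hQ₁₂, Units.val_mul _ (arcSign κ P τ), ← mul_assoc]
  rfl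

theorem preKey_eq_leadingKey (κ : Convention) (s : D.State) (τ : Fin D.n) :
    g.preKey κ s τ = leadingKey (D.cycle₁ κ s τ) (D.cycle₂ κ s τ) fun c => g.order s c := by
  funext c
  rw [preKey, leadingKey]
  congr

theorem postKey_eq_leadingKey (κ : Convention) (s t : D.State) (τ : Fin D.n) :
    g.postKey κ s t τ = leadingKey (D.cycle₁ κ t τ) (D.cycle₂ κ t τ)
      fun c => g.order s (g.carry s t c) := by
  funext c
  rw [postKey, leadingKey]
  congr

theorem isMergeSign_edgeSign_of_merge (κ : Convention) (hf : FlipAt τ s t) (hs : Separated s τ) :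
    g.IsMergeSign κ s t τ (g.edgeSign κ s t τ) := by
  rw [edgeSign, mul_comm, preKey_eq_leadingKey, postKey_eq_leadingKey]
  refine g.isMergeSign_of_leadingKey hf hs ?_ fun c h₁ h₂ => ?_
  · exact (Fin.val_injective.comp (g.order s).injective).injOn
  · obtain ⟨p, rfl⟩ := cycleThrough_surjective s c
    have hp : ¬Meets t τ p := hf.meets_iff.not.2 ((not_meets_iff κ).2 ⟨h₁, h₂⟩)
    rw [g.carry_cycleThrough hf (hf.not_separated hs), g.carry_cycleThrough_of_not_meets hf hp]

theorem isMergeSign_edgeSign_of_split (κ : Convention) (hf : FlipAt τ s t) (ht : Separated t τ) :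
    g.IsMergeSign κ t s τ (g.edgeSign κ s t τ) := by
  rw [edgeSign, preKey_eq_leadingKey, postKey_eq_leadingKey]
  refine g.isMergeSign_of_leadingKey hf.symm ht ?_ fun _ _ _ => rfl
  refine (Fin.val_injective.comp (g.order s).injective).comp_injOn
    ((g.carry_injOn (κ := κ) hf.symm (hf.symm.not_separated ht)).mono ?_)
  exact Set.compl_subset_compl.2 fun _ hc => .inr hc

end GlobalChoice

end Signs

/-! ### Faces of the cube -/

section Faces

variable {D : Diagram} {κ : Convention} {s s₁ s₂ t : D.State} {τ τ₁ τ₂ : Fin D.n}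
  {o : D.HalfEdge → ℤˣ} {v v' : D.Point → ℤ}

/-- The states `s`, `s₁`, `s₂`, `t` are the corners of a face of the cube: `s₁` and `s₂` arise from
`s`, and `t` from `s₂` and `s₁`, by changing the smoothings at the different crossings `τ₁` and
`τ₂`. -/
structure Face (τ₁ τ₂ : Fin D.n) (s s₁ s₂ t : D.State) : Prop where
  ne : τ₁ ≠ τ₂
  flip₁ : FlipAt τ₁ s s₁
  flip₁₂ : FlipAt τ₂ s₁ t
  flip₂ : FlipAt τ₂ s s₂
  flip₂₁ : FlipAt τ₁ s₂ t

namespace Face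

theorem symm (F : Face τ₁ τ₂ s s₁ s₂ t) : Face τ₂ τ₁ s s₂ s₁ t :=
  ⟨F.ne.symm, F.flip₂, F.flip₂₁, F.flip₁, F.flip₁₂⟩

theorem rotate (F : Face τ₁ τ₂ s s₁ s₂ t) : Face τ₂ τ₁ s₂ s t s₁ :=
  ⟨F.ne.symm, F.flip₂.symm, F.flip₁, F.flip₂₁, F.flip₁₂.symm⟩

theorem arcSign₁ (F : Face τ₁ τ₂ s s₁ s₂ t) : arcSign κ s₂ τ₁ = arcSign κ s τ₁ :=
  arcSign_congr κ (F.flip₂.2 _ F.ne).symm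

theorem arcSign₁₂ (F : Face τ₁ τ₂ s s₁ s₂ t) : arcSign κ t τ₁ = arcSign κ s₁ τ₁ :=
  arcSign_congr κ (F.flip₁₂.2 _ F.ne).symm

theorem arcSign_mul (F : Face τ₁ τ₂ s s₁ s₂ t) :
    arcSign κ s τ₁ * arcSign κ t τ₁ = arcSign κ s τ₂ * arcSign κ t τ₂ := by
  rw [F.arcSign₁₂, F.symm.arcSign₁₂, F.flip₁.arcSign_mul F.flip₂]

/-- Both sides come from one determinant on `s`: the two merges remove its first two columns, in
opposite orders. -/
theorem mergeSign_mul (F : Face τ₁ τ₂ s s₁ s₂ t) (g : D.GlobalChoice) {ε₁ ε₂ δ₁ δ₂ : ℤˣ}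
    (hs₁ : Separated s τ₁) (hs₂ : Separated s τ₂) (hs₁₂ : Separated s₁ τ₂)
    (hs₂₁ : Separated s₂ τ₁)
    (h₁ : g.IsMergeSign κ s s₁ τ₁ ε₁) (h₁₂ : g.IsMergeSign κ s₁ t τ₂ ε₂)
    (h₂ : g.IsMergeSign κ s s₂ τ₂ δ₂) (h₂₁ : g.IsMergeSign κ s₂ t τ₁ δ₁) :
    ε₁ * ε₂ = -(δ₂ * δ₁) := by
  obtain ⟨n, ht⟩ : ∃ n, Fintype.card (D.Cycle t) = n := ⟨_, rfl⟩
  have hc₁ : Fintype.card (D.Cycle s₁) = n + 1 := by rw [F.flip₁₂.card_of_merge hs₁₂, ht]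
  have hc₂ : Fintype.card (D.Cycle s₂) = n + 1 := by rw [F.flip₂₁.card_of_merge hs₂₁, ht]
  have hc : Fintype.card (D.Cycle s) = n + 2 := by rw [F.flip₁.card_of_merge hs₁, hc₁]
  obtain ⟨w, hw, hdet⟩ := g.exists_cycleDet_eq_one t ht
  have hv₁ := constOnCycles_indicator (D.cycleAt s₂ (τ₁, .sw))
  have hv₂ := constOnCycles_indicator (D.cycleAt s₁ (τ₂, .sw))
  have hd₁ := cornerDiff_indicator hs₂₁
  have hd₂ := cornerDiff_indicator hs₁₂
  set v₁ := indicator (D.cycleAt s₂ (τ₁, .sw))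
  set v₂ := indicator (D.cycleAt s₁ (τ₂, .sw))
  have path₁ := h₁ _ hc hc₁ v₁ (Fin.cons v₂ w) (hv₁.of_merge F.flip₂ hs₂)
    (Fin.cases hv₂ fun j => (hw j).of_merge F.flip₁₂ hs₁₂)
  have path₂ := h₂ _ hc hc₂ v₂ (Fin.cons v₁ w) (hv₂.of_merge F.flip₁ hs₁)
    (Fin.cases hv₁ fun j => (hw j).of_merge F.flip₂₁ hs₂₁)
  rw [h₁₂ _ hc₁ ht v₂ w hv₂ hw, hd₁, hd₂, hdet, mul_one, mul_one, mul_one] at path₁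
  rw [h₂₁ _ hc₂ ht v₁ w hv₁ hw, hd₁, hd₂, hdet, mul_one, mul_one, mul_one] at path₂
  rw [g.cycleDet_swap, path₂, ← Units.val_mul, ← Units.val_mul, ← Units.val_neg, Units.val_inj,
    F.arcSign₁, ← F.symm.arcSign₁, mul_mul_mul_comm, mul_mul_mul_comm ε₁, ← neg_mul,
    mul_comm (arcSign κ s τ₁)] at path₁
  exact (mul_right_cancel path₁).symm

end Face

/-- In `s`, the two cycles through `τ₁` are the two cycles through `τ₂`; the corners `sw` and `ne`
of the crossings are matched if `u = 1`, and crosswise if `u = -1`. -/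
def IsMatching (s : D.State) (τ₁ τ₂ : Fin D.n) (u : ℤˣ) : Prop :=
  (u = 1 ∧ D.cycleAt s (τ₂, .sw) = D.cycleAt s (τ₁, .sw) ∧
    D.cycleAt s (τ₂, .ne) = D.cycleAt s (τ₁, .ne)) ∨
  (u = -1 ∧ D.cycleAt s (τ₂, .sw) = D.cycleAt s (τ₁, .ne) ∧
    D.cycleAt s (τ₂, .ne) = D.cycleAt s (τ₁, .sw))

theorem exists_isMatching (hf : FlipAt τ₁ s t) (hs : Separated s τ₂) (ht : ¬Separated t τ₂) :
    ∃ u, IsMatching s τ₁ τ₂ u := by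
  have heq : cycleThrough t (.inl (τ₂, .sw)) = cycleThrough t (.inl (τ₂, .ne)) := not_not.1 ht
  rcases hf.cycleThrough_eq_or_meets heq with h | ⟨h | h, h' | h'⟩
  · exact (hs h).elim
  · exact (hs (h.trans h'.symm)).elim
  · exact ⟨1, .inl ⟨rfl, h, h'⟩⟩
  · exact ⟨-1, .inr ⟨rfl, h, h'⟩⟩
  · exact (hs (h.trans h'.symm)).elim

namespace IsMatching

variable {u : ℤˣ}

theorem of_flip (h : IsMatching s τ₁ τ₂ u) (hf : FlipAt τ s t) (ht : ¬Separated t τ) :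
    IsMatching t τ₁ τ₂ u := by
  have hflip {a b : D.HalfEdge} : D.cycleAt s a = D.cycleAt s b → D.cycleAt t a = D.cycleAt t b :=
    hf.cycleThrough_eq_of_not_separated (p := .inl a) (p' := .inl b) ht
  exact h.imp (.imp_right (.imp hflip hflip)) (.imp_right (.imp hflip hflip))

theorem cornerDiff_eq (h : IsMatching s τ₁ τ₂ u) (hv : ConstOnCycles s v) :
    cornerDiff τ₂ v = u * cornerDiff τ₁ v := by
  have hval {a b : D.HalfEdge} (hab : D.cycleAt s a = D.cycleAt s b) : v (.inl a) = v (.inl b) :=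
    hv _ _ hab
  rcases h with ⟨rfl, hsw, hne⟩ | ⟨rfl, hsw, hne⟩
  · rw [cornerDiff, hval hsw, hval hne, Units.val_one, one_mul, cornerDiff]
  · rw [cornerDiff, hval hsw, hval hne, Units.val_neg, Units.val_one, neg_one_mul, cornerDiff,
      neg_sub]

end IsMatching

/-- One family of functions, constant both on the cycles of `s₁` and on those of `s₂`, evaluates all
four signs. -/
theorem Face.mergeSign_mul_eq_matching_mul (F : Face τ₁ τ₂ s s₁ s₂ t) (g : D.GlobalChoice)
    {ε₁ ε₂ δ₁ δ₂ u u' : ℤˣ} (hs₁ : Separated s τ₁) (hs₂ : Separated s τ₂)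
    (ht₁ : Separated t τ₁) (ht₂ : Separated t τ₂) (hu : IsMatching s τ₁ τ₂ u)
    (hu' : IsMatching t τ₁ τ₂ u')
    (h₁ : g.IsMergeSign κ s s₁ τ₁ ε₁) (h₁₂ : g.IsMergeSign κ t s₁ τ₂ ε₂)
    (h₂ : g.IsMergeSign κ s s₂ τ₂ δ₂) (h₂₁ : g.IsMergeSign κ t s₂ τ₁ δ₁) :
    ε₁ * ε₂ * (δ₂ * δ₁) = u * u' := by
  obtain ⟨n, hc₁⟩ : ∃ n, Fintype.card (D.Cycle s₁) = n := ⟨_, rfl⟩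
  have hc : Fintype.card (D.Cycle s) = n + 1 := by rw [F.flip₁.card_of_merge hs₁, hc₁]
  have hct : Fintype.card (D.Cycle t) = n + 1 := by rw [F.flip₁₂.symm.card_of_merge ht₂, hc₁]
  have hc₂ : Fintype.card (D.Cycle s₂) = n :=
    Nat.succ_injective ((F.flip₂.card_of_merge hs₂).symm.trans hc)
  obtain ⟨w, hw, hdet⟩ := g.exists_cycleDet_eq_one s₁ hc₁
  have hw₂ (j : Fin n) : ConstOnCycles s₂ (w j) :=
    ((hw j).of_merge F.flip₁ hs₁).flip F.flip₂
      ((hw j).cornerDiff_eq_zero (F.flip₁₂.symm.not_separated ht₂))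
  have hv := constOnCycles_indicator (D.cycleAt s (τ₁, .sw))
  have hv' := constOnCycles_indicator (D.cycleAt t (τ₁, .sw))
  have dets := (h₁ n hc hc₁ _ w hv hw).symm.trans (h₂ n hc hc₂ _ w hv hw₂)
  have dets' := (h₁₂ n hct hc₁ _ w hv' hw).symm.trans (h₂₁ n hct hc₂ _ w hv' hw₂)
  rw [hu.cornerDiff_eq hv, cornerDiff_indicator hs₁, hdet, mul_one, mul_one, mul_one] at dets
  rw [hu'.cornerDiff_eq hv', cornerDiff_indicator ht₁, hdet, mul_one, mul_one, mul_one] at dets'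
  have hmul : ε₁ * arcSign κ s τ₁ * (δ₁ * arcSign κ t τ₁) =
      δ₂ * arcSign κ s τ₂ * u * (ε₂ * arcSign κ t τ₂ * u') := by
    ext
    rw [Units.val_mul, Units.val_mul _ (_ * u'), Units.val_mul _ u', Units.val_mul _ u, dets,
      dets', mul_assoc, mul_comm (g.cycleDet s₂ hc₂ w)]
  rw [mul_mul_mul_comm, F.arcSign_mul, mul_mul_mul_comm (δ₂ * _), mul_mul_mul_comm δ₂,
    mul_right_comm _ _ (u * u')] at hmul
  rw [mul_comm δ₂, mul_mul_mul_comm, mul_right_cancel hmul, mul_right_comm, mul_comm ε₂,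
    Int.units_mul_self, one_mul]

theorem sum_corners_eq_zero {w : D.HalfEdge → ℤ} (S : Finset (Fin D.n))
    (hglue : ∀ h, w (D.glue h) = -w h) (hsmooth : ∀ h, h.1 ∉ S → w (D.smooth s h) = -w h) :
    ∑ c ∈ S, ∑ x, w (c, x) = 0 := by
  have htotal : ∑ h, w h = 0 := by
    have hneg : ∑ h, w h = -∑ h, w h := by
      rw [← Finset.sum_neg_distrib, ← Equiv.sum_comp (gluePerm D)]
      exact Finset.sum_congr rfl fun h _ => hglue h
    exact self_eq_neg.1 hneg
  rw [Fintype.sum_prod_type] at htotal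
  rw [← htotal]
  refine Finset.sum_subset (Finset.subset_univ S) fun c _ hc => ?_
  obtain ⟨y, y', hy, hsw, hne⟩ := exists_smooth_corners s c
  have hy₁ := hsmooth (c, .sw) hc
  have hy₂ := hsmooth (c, .ne) hc
  rw [hsw] at hy₁
  rw [hne] at hy₂
  rw [Corner.sum_eq]
  rcases hy with ⟨rfl, rfl⟩ | ⟨rfl, rfl⟩ <;> linarith

theorem FlipAt.sum_corners (hf : FlipAt τ s t) (ho : IsOrientation s o)
    (h : o (τ, .sw) = o (τ, .ne)) {f f' : D.HalfEdge → ℤ}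
    (hfs : ∀ x, f (D.smooth s (τ, x)) = f (τ, x)) (hft : ∀ x, f' (D.smooth t (τ, x)) = f' (τ, x)) :
    ∑ x, o (τ, x) * (f (τ, x) * f' (τ, x)) =
      o (τ, .sw) * ((f (τ, .sw) - f (τ, .ne)) * (f' (τ, .sw) - f' (τ, .ne))) := by
  obtain ⟨y, y', hy, hsw, hne, hsw', hne'⟩ := hf.exists_corners
  have ho₁ := ho.smooth (τ, .sw)
  have ho₂ := ho.smooth (τ, .ne)
  have hf₁ := hfs .sw
  have hf₂ := hfs .ne
  have hf₁' := hft .sw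
  have hf₂' := hft .ne
  rw [hsw] at ho₁ hf₁
  rw [hne, ← h] at ho₂
  rw [hne] at hf₂
  rw [hsw'] at hf₁'
  rw [hne'] at hf₂'
  rw [Corner.sum_eq]
  rcases hy with ⟨rfl, rfl⟩ | ⟨rfl, rfl⟩ <;>
    rw [hf₁, hf₂, hf₁', hf₂', ho₁, ho₂, ← h, Units.val_neg] <;> ring

/-- For indicator functions this is an algebraic intersection number of a cycle of `s` and a cycle
of `t`, which cross at most at `τ₁` and `τ₂`. -/
theorem sum_orientation_mul_cornerDiff_eq_zero (hτ : τ₁ ≠ τ₂) (hf₁ : FlipAt τ₁ s s₁)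
    (hf₂ : FlipAt τ₂ s₁ t) (ho : IsOrientation s₁ o) (h₁ : o (τ₁, .sw) = o (τ₁, .ne))
    (h₂ : o (τ₂, .sw) = o (τ₂, .ne)) (hv : ConstOnCycles s v) (hv' : ConstOnCycles t v') :
    o (τ₁, .sw) * (cornerDiff τ₁ v * cornerDiff τ₁ v') +
      o (τ₂, .sw) * (cornerDiff τ₂ v * cornerDiff τ₂ v') = 0 := by
  have hoff (h : D.HalfEdge) (hh : h.1 ∉ ({τ₁, τ₂} : Finset (Fin D.n))) :
      D.smooth s₁ h = D.smooth s h ∧ D.smooth s₁ h = D.smooth t h := by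
    simp only [Finset.mem_insert, Finset.mem_singleton, not_or] at hh
    exact ⟨hf₁.smooth_eq hh.1, (hf₂.smooth_eq hh.2).symm⟩
  have hsum := sum_corners_eq_zero (s := s₁) (w := fun h => o h * (v (.inl h) * v' (.inl h)))
    {τ₁, τ₂} (fun h => by rw [ho.glue, hv.glue, hv'.glue, Units.val_neg, neg_mul])
    (fun h hh => by
      rw [ho.smooth, (hoff h hh).1, hv.smooth, ← (hoff h hh).1, (hoff h hh).2, hv'.smooth,
        Units.val_neg, neg_mul])
  have hsum₁ := hf₁.sum_corners (ho.flip hf₁.symm h₁) h₁ (f := fun h => v (.inl h))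
    (f' := fun h => v' (.inl h)) (fun x => hv.smooth _)
    (fun x => by rw [← hf₂.smooth_eq (a := (τ₁, x)) hτ, hv'.smooth])
  have hsum₂ := hf₂.sum_corners ho h₂ (f := fun h => v (.inl h)) (f' := fun h => v' (.inl h))
    (fun x => by rw [hf₁.smooth_eq (a := (τ₂, x)) hτ.symm, hv.smooth]) (fun x => hv'.smooth _)
  rwa [Finset.sum_pair hτ, hsum₁, hsum₂] at hsum

theorem matching_mul_matching {u u' : ℤˣ} (hτ : τ₁ ≠ τ₂) (hf₁ : FlipAt τ₁ s s₁)
    (hf₂ : FlipAt τ₂ s₁ t) (ho : IsOrientation s₁ o) (hs₁ : Separated s τ₁)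
    (ht₁ : Separated t τ₁) (ht₂ : Separated t τ₂) (hu : IsMatching s τ₁ τ₂ u)
    (hu' : IsMatching t τ₁ τ₂ u') : u * u' * (o (τ₁, .sw) * o (τ₂, .sw)) = -1 := by
  have hv := constOnCycles_indicator (D.cycleAt s (τ₁, .sw))
  have hv' := constOnCycles_indicator (D.cycleAt t (τ₁, .sw))
  have hsum := sum_orientation_mul_cornerDiff_eq_zero hτ hf₁ hf₂ ho
    ((hf₁.symm.separated_iff ho).1 hs₁).2 ((hf₂.separated_iff ho).1 ht₂).2 hv hv'
  rw [hu.cornerDiff_eq hv, hu'.cornerDiff_eq hv', cornerDiff_indicator hs₁,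
    cornerDiff_indicator ht₁, mul_one, mul_one, mul_one, mul_one, ← Units.val_mul u,
    ← Units.val_mul, add_eq_zero_iff_eq_neg, ← Units.val_neg, Units.val_inj] at hsum
  rw [hsum, neg_mul, mul_neg, mul_assoc (o _), ← mul_assoc, Int.units_mul_self]

theorem Face.mergeSign_mul_of_bigon (F : Face τ₁ τ₂ s s₁ s₂ t) (g : D.GlobalChoice)
    {ε₁ ε₂ δ₁ δ₂ : ℤˣ} (hs₁ : Separated s τ₁) (hs₂ : Separated s τ₂) (ht₁ : Separated t τ₁)
    (ht₂ : Separated t τ₂) (ho : IsOrientation s₁ o)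
    (h₁ : g.IsMergeSign κ s s₁ τ₁ ε₁) (h₁₂ : g.IsMergeSign κ t s₁ τ₂ ε₂)
    (h₂ : g.IsMergeSign κ s s₂ τ₂ δ₂) (h₂₁ : g.IsMergeSign κ t s₂ τ₁ δ₁) :
    ε₁ * ε₂ * (δ₂ * δ₁) = -(o (τ₁, .sw) * o (τ₂, .sw)) := by
  obtain ⟨u, hu⟩ := exists_isMatching F.flip₁ hs₂ (F.flip₁₂.symm.not_separated ht₂)
  obtain ⟨u', hu'⟩ := exists_isMatching F.flip₂₁.symm ht₂ (F.flip₂.not_separated hs₂)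
  rw [F.mergeSign_mul_eq_matching_mul g hs₁ hs₂ ht₁ ht₂ hu hu' h₁ h₁₂ h₂ h₂₁, ← mul_one (u * u'),
    ← Int.units_mul_self (o (τ₁, .sw) * o (τ₂, .sw)), ← mul_assoc,
    matching_mul_matching F.ne F.flip₁ F.flip₁₂ ho hs₁ ht₁ ht₂ hu hu', neg_one_mul]

end Faces

/-! ### Anticommutativity -/

section Anticommutativity

variable {D : Diagram} {κ : Convention} {s s₁ s₂ t : D.State} {τ τ₁ τ₂ : Fin D.n}

namespace GlobalChoice

variable (k : Type*) [CommRing k] (g : D.GlobalChoice)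

theorem opX_eq_of_cycleAt_eq (ho : IsOrientation s o) {a b : D.HalfEdge}
    (h : D.cycleAt s a = D.cycleAt s b) : g.opX k κ s (.inl a) =
      ((align κ o a * align κ o b : ℤˣ) : ℤ) • g.opX k κ s (.inl b) := by
  have hab : cycleThrough s (.inl a) = cycleThrough s (.inl b) := h
  rw [opX, hab, g.mulX_cycleThrough k κ, smul_smul, ← Units.val_mul, g.transport_mul ho h]

theorem sumX_eq_of_isMatching (ho : IsOrientation s o) (h₁ : o (τ₁, .sw) = o (τ₁, .ne))
    (h₂ : o (τ₂, .sw) = o (τ₂, .ne)) {u : ℤˣ} (h : IsMatching s τ₁ τ₂ u) :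
    g.sumX k κ s τ₂ = ((o (τ₁, .sw) * o (τ₂, .sw) : ℤˣ) : ℤ) • g.sumX k κ s τ₁ := by
  have hopX {x y : Corner} (hxy : D.cycleAt s (τ₂, x) = D.cycleAt s (τ₁, y)) :
      g.opX k κ s (.inl (τ₂, x)) =
        ((o (τ₁, .sw) * o (τ₂, .sw) : ℤˣ) : ℤ) • g.opX k κ s (.inl (τ₁, y)) := by
    rw [g.opX_eq_of_cycleAt_eq k ho hxy, ho.align_corner h₂, ho.align_corner h₁, align, align,
      mul_mul_mul_comm, Int.units_mul_self, one_mul, mul_comm]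
  rcases h with ⟨-, hsw, hne⟩ | ⟨-, hsw, hne⟩
  · rw [sumX, hopX hsw, hopX hne, sumX, smul_add]
  · rw [sumX, hopX hsw, hopX hne, sumX, smul_add, add_comm]

/-- The two arcs at a crossing whose flip turns one cycle into one cycle have opposite directions,
so their operators cancel. -/
theorem sumX_eq_zero (hf : FlipAt τ s t) (hs : ¬Separated s τ) (ht : ¬Separated t τ) :
    g.sumX k κ t τ = 0 := by
  obtain ⟨o, ho⟩ := exists_isOrientation t
  have hne : o (τ, .sw) ≠ o (τ, .ne) := fun h => hs ((hf.symm.separated_iff ho).2 ⟨ht, h⟩)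
  have halign : align κ o (τ, .sw) * align κ o (τ, .ne) = -1 := by
    rw [align, align, Int.units_ne_iff_eq_neg.1 hne, κ.inSign_ne, mul_neg, neg_mul,
      Int.units_mul_self]
  rw [sumX, g.opX_eq_of_cycleAt_eq k ho (not_not.1 ht), halign, Units.val_neg, Units.val_one,
    neg_one_zsmul, neg_add_cancel]

theorem partialDiff_unit_of_merge_merge (hf₁ : FlipAt τ₁ s s₁) (hf₂ : FlipAt τ₂ s₁ t)
    (h₁ : Separated s τ₁) (h₂ : Separated s₁ τ₂) :
    g.partialDiff k κ s₁ t τ₂ (g.partialDiff k κ s s₁ τ₁ (unit k s)) =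
      ((g.edgeSign κ s s₁ τ₁ * g.edgeSign κ s₁ t τ₂ : ℤˣ) : ℤ) • unit k t := by
  rw [g.partialDiff_unit_of_merge k hf₁ h₁, map_zsmul, g.partialDiff_unit_of_merge k hf₂ h₂,
    smul_smul, Units.val_mul]

theorem partialDiff_unit_of_merge_split (hf₁ : FlipAt τ₁ s s₁) (hf₂ : FlipAt τ₂ s₁ t)
    (h₁ : Separated s τ₁) (h₂ : Separated t τ₂) :
    g.partialDiff k κ s₁ t τ₂ (g.partialDiff k κ s s₁ τ₁ (unit k s)) =
      ((g.edgeSign κ s s₁ τ₁ * g.edgeSign κ s₁ t τ₂ : ℤˣ) : ℤ) • g.sumX k κ t τ₂ (unit k t) := by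
  rw [g.partialDiff_unit_of_merge k hf₁ h₁, map_zsmul, g.partialDiff_unit_of_split k hf₂ h₂,
    smul_smul, Units.val_mul]

theorem partialDiff_unit_of_split_merge (hf₁ : FlipAt τ₁ s s₁) (hf₂ : FlipAt τ₂ s₁ t)
    (h₁ : Separated s₁ τ₁) (h₂ : Separated s₁ τ₂) :
    g.partialDiff k κ s₁ t τ₂ (g.partialDiff k κ s s₁ τ₁ (unit k s)) =
      ((g.edgeSign κ s s₁ τ₁ * g.edgeSign κ s₁ t τ₂ : ℤˣ) : ℤ) • g.sumX k κ t τ₁ (unit k t) := by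
  rw [g.partialDiff_unit_of_split k hf₁ h₁, map_zsmul, g.partialDiff_sumX k hf₂,
    g.partialDiff_unit_of_merge k hf₂ h₂, map_zsmul, smul_smul, Units.val_mul]

theorem partialDiff_unit_of_split_split (hf₁ : FlipAt τ₁ s s₁) (hf₂ : FlipAt τ₂ s₁ t)
    (h₁ : Separated s₁ τ₁) (h₂ : Separated t τ₂) :
    g.partialDiff k κ s₁ t τ₂ (g.partialDiff k κ s s₁ τ₁ (unit k s)) =
      ((g.edgeSign κ s s₁ τ₁ * g.edgeSign κ s₁ t τ₂ : ℤˣ) : ℤ) •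
        g.sumX k κ t τ₁ (g.sumX k κ t τ₂ (unit k t)) := by
  rw [g.partialDiff_unit_of_split k hf₁ h₁, map_zsmul, g.partialDiff_sumX k hf₂,
    g.partialDiff_unit_of_split k hf₂ h₂, map_zsmul, smul_smul, Units.val_mul]

theorem partialDiff_partialDiff_eq_zero (h : (¬Separated s τ₁ ∧ ¬Separated s₁ τ₁) ∨
    (¬Separated s₁ τ₂ ∧ ¬Separated t τ₂)) (x : D.Chain k s) :
    g.partialDiff k κ s₁ t τ₂ (g.partialDiff k κ s s₁ τ₁ x) = 0 := by
  rcases h with h | h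
  · rw [g.partialDiff_eq_zero k h.1 h.2, LinearMap.zero_apply, map_zero]
  · rw [g.partialDiff_eq_zero k h.1 h.2, LinearMap.zero_apply]

end GlobalChoice

theorem FlipAt.trichotomy (hf : FlipAt τ s t) :
    (Separated s τ ∧ Fintype.card (D.Cycle s) = Fintype.card (D.Cycle t) + 1) ∨
    (Separated t τ ∧ Fintype.card (D.Cycle t) = Fintype.card (D.Cycle s) + 1) ∨
    ((¬Separated s τ ∧ ¬Separated t τ) ∧
      Fintype.card (D.Cycle s) = Fintype.card (D.Cycle t)) := by
  by_cases hs : Separated s τ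
  · exact .inl ⟨hs, hf.card_of_merge hs⟩
  by_cases ht : Separated t τ
  · exact .inr (.inl ⟨ht, hf.symm.card_of_merge ht⟩)
  · exact .inr (.inr ⟨⟨hs, ht⟩, hf.card_of_not_separated hs ht⟩)

theorem zsmul_eq_neg_zsmul {M : Type*} [AddCommGroup M] {a b : ℤˣ} (h : a = -b) (x : M) :
    (a : ℤ) • x = -((b : ℤ) • x) := by
  rw [h, Units.val_neg, neg_smul]

theorem mul_eq_neg_of_mul_eq_neg {a b c : ℤˣ} (h : a * b = -c) : a * c = -b := by
  rw [← neg_eq_iff_eq_neg.2 h, mul_neg, ← mul_assoc, Int.units_mul_self, one_mul]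

namespace Face

variable (F : Face τ₁ τ₂ s s₁ s₂ t) (k : Type*) [CommRing k] (g : D.GlobalChoice)
include F

theorem anticomm_unit_of_merge_merge (hs₁ : Separated s τ₁) (hs₁₂ : Separated s₁ τ₂)
    (hs₂ : Separated s τ₂) (hs₂₁ : Separated s₂ τ₁) :
    g.partialDiff k κ s₁ t τ₂ (g.partialDiff k κ s s₁ τ₁ (unit k s)) =
      -g.partialDiff k κ s₂ t τ₁ (g.partialDiff k κ s s₂ τ₂ (unit k s)) := by
  rw [g.partialDiff_unit_of_merge_merge k F.flip₁ F.flip₁₂ hs₁ hs₁₂,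
    g.partialDiff_unit_of_merge_merge k F.flip₂ F.flip₂₁ hs₂ hs₂₁]
  exact zsmul_eq_neg_zsmul (F.mergeSign_mul g hs₁ hs₂ hs₁₂ hs₂₁
    (g.isMergeSign_edgeSign_of_merge κ F.flip₁ hs₁)
    (g.isMergeSign_edgeSign_of_merge κ F.flip₁₂ hs₁₂)
    (g.isMergeSign_edgeSign_of_merge κ F.flip₂ hs₂)
    (g.isMergeSign_edgeSign_of_merge κ F.flip₂₁ hs₂₁)) _

theorem anticomm_unit_of_split_split (hs₁ : Separated s₁ τ₁) (ht₂ : Separated t τ₂)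
    (hs₂ : Separated s₂ τ₂) (ht₁ : Separated t τ₁) :
    g.partialDiff k κ s₁ t τ₂ (g.partialDiff k κ s s₁ τ₁ (unit k s)) =
      -g.partialDiff k κ s₂ t τ₁ (g.partialDiff k κ s s₂ τ₂ (unit k s)) := by
  have hsign := F.rotate.rotate.mergeSign_mul g ht₁ ht₂ hs₂ hs₁
    (g.isMergeSign_edgeSign_of_split κ F.flip₂₁ ht₁)
    (g.isMergeSign_edgeSign_of_split κ F.flip₂ hs₂)
    (g.isMergeSign_edgeSign_of_split κ F.flip₁₂ ht₂)
    (g.isMergeSign_edgeSign_of_split κ F.flip₁ hs₁)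
  rw [g.partialDiff_unit_of_split_split k F.flip₁ F.flip₁₂ hs₁ ht₂,
    g.partialDiff_unit_of_split_split k F.flip₂ F.flip₂₁ hs₂ ht₁, g.sumX_comm k]
  refine zsmul_eq_neg_zsmul ?_ _
  rw [mul_comm, mul_comm (g.edgeSign κ s s₂ τ₂), hsign, neg_neg]

theorem anticomm_unit_of_merge_split_of_split_merge (hs : Separated s τ₁) (ht : Separated t τ₂)
    (hs₂ : Separated s₂ τ₂) (hs₂₁ : Separated s₂ τ₁) :
    g.partialDiff k κ s₁ t τ₂ (g.partialDiff k κ s s₁ τ₁ (unit k s)) =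
      -g.partialDiff k κ s₂ t τ₁ (g.partialDiff k κ s s₂ τ₂ (unit k s)) := by
  have hsign := F.rotate.mergeSign_mul g hs₂ hs₂₁ hs ht
    (g.isMergeSign_edgeSign_of_split κ F.flip₂ hs₂)
    (g.isMergeSign_edgeSign_of_merge κ F.flip₁ hs)
    (g.isMergeSign_edgeSign_of_merge κ F.flip₂₁ hs₂₁)
    (g.isMergeSign_edgeSign_of_split κ F.flip₁₂ ht)
  rw [g.partialDiff_unit_of_merge_split k F.flip₁ F.flip₁₂ hs ht,
    g.partialDiff_unit_of_split_merge k F.flip₂ F.flip₂₁ hs₂ hs₂₁]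
  refine zsmul_eq_neg_zsmul ?_ _
  have hfour (a b c d : ℤˣ) : a * b = -(c * d) → b * d = -(a * c) := by
    revert a b c d; decide
  exact hfour _ _ _ _ hsign

theorem anticomm_unit_of_merge_split_of_merge_split (hs₁ : Separated s τ₁) (ht₂ : Separated t τ₂)
    (hs₂ : Separated s τ₂) (ht₁ : Separated t τ₁) :
    g.partialDiff k κ s₁ t τ₂ (g.partialDiff k κ s s₁ τ₁ (unit k s)) =
      -g.partialDiff k κ s₂ t τ₁ (g.partialDiff k κ s s₂ τ₂ (unit k s)) := by
  obtain ⟨o, ho⟩ := exists_isOrientation s₁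
  have ho₁ := ((F.flip₁.symm.separated_iff ho).1 hs₁).2
  have ho₂ := ((F.flip₁₂.separated_iff ho).1 ht₂).2
  obtain ⟨u, hu⟩ := exists_isMatching F.flip₂₁.symm ht₂ (F.flip₂.not_separated hs₂)
  have hsign := F.mergeSign_mul_of_bigon g hs₁ hs₂ ht₁ ht₂ ho
    (g.isMergeSign_edgeSign_of_merge κ F.flip₁ hs₁)
    (g.isMergeSign_edgeSign_of_split κ F.flip₁₂ ht₂)
    (g.isMergeSign_edgeSign_of_merge κ F.flip₂ hs₂)
    (g.isMergeSign_edgeSign_of_split κ F.flip₂₁ ht₁)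
  rw [g.partialDiff_unit_of_merge_split k F.flip₁ F.flip₁₂ hs₁ ht₂,
    g.partialDiff_unit_of_merge_split k F.flip₂ F.flip₂₁ hs₂ ht₁,
    g.sumX_eq_of_isMatching k (ho.flip F.flip₁₂ ho₂) ho₁ ho₂ hu, LinearMap.smul_apply, smul_smul,
    ← Units.val_mul]
  exact zsmul_eq_neg_zsmul (mul_eq_neg_of_mul_eq_neg hsign) _

theorem anticomm_unit_of_split_merge_of_split_merge (hs₁ : Separated s₁ τ₁) (hs₁₂ : Separated s₁ τ₂)
    (hs₂ : Separated s₂ τ₂) (hs₂₁ : Separated s₂ τ₁) :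
    g.partialDiff k κ s₁ t τ₂ (g.partialDiff k κ s s₁ τ₁ (unit k s)) =
      -g.partialDiff k κ s₂ t τ₁ (g.partialDiff k κ s s₂ τ₂ (unit k s)) := by
  obtain ⟨o, ho⟩ := exists_isOrientation s
  have ho₁ := ((F.flip₁.separated_iff ho).1 hs₁).2
  have ho₂ := ((F.flip₂.separated_iff ho).1 hs₂).2
  obtain ⟨u, hu⟩ := exists_isMatching F.flip₁.symm hs₁₂ (F.flip₂.symm.not_separated hs₂)
  have hu' := hu.of_flip F.flip₁₂ (F.flip₁₂.not_separated hs₁₂)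
  have hsign := F.symm.rotate.mergeSign_mul_of_bigon g hs₁ hs₁₂ hs₂₁ hs₂ ho
    (g.isMergeSign_edgeSign_of_split κ F.flip₁ hs₁)
    (g.isMergeSign_edgeSign_of_split κ F.flip₂ hs₂)
    (g.isMergeSign_edgeSign_of_merge κ F.flip₁₂ hs₁₂)
    (g.isMergeSign_edgeSign_of_merge κ F.flip₂₁ hs₂₁)
  rw [mul_mul_mul_comm, mul_comm] at hsign
  have hsign' := neg_eq_iff_eq_neg.2 (mul_eq_neg_of_mul_eq_neg hsign)
  rw [g.partialDiff_unit_of_split_merge k F.flip₁ F.flip₁₂ hs₁ hs₁₂,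
    g.partialDiff_unit_of_split_merge k F.flip₂ F.flip₂₁ hs₂ hs₂₁,
    g.sumX_eq_of_isMatching k ((ho.flip F.flip₁ ho₁).flip F.flip₁₂ ho₂) ho₁ ho₂ hu',
    LinearMap.smul_apply, smul_smul, ← Units.val_mul]
  exact zsmul_eq_neg_zsmul hsign'.symm _

theorem partialDiff_unit_eq_zero (h : (¬Separated s τ₂ ∧ ¬Separated s₂ τ₂) ∨
    (¬Separated s₂ τ₁ ∧ ¬Separated t τ₁)) :
    g.partialDiff k κ s₁ t τ₂ (g.partialDiff k κ s s₁ τ₁ (unit k s)) = 0 := by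
  have h₂ := F.flip₂.trichotomy
  have h₂₁ := F.flip₂₁.trichotomy
  have hstay (hs₁ : Separated s τ₁) (hs₂ : ¬Separated s τ₂) : Separated s₂ τ₁ :=
    fun hs₂₁ => hs₁ (F.flip₂.symm.cycleThrough_eq_of_not_separated (p := .inl (τ₁, .sw))
      (p' := .inl (τ₁, .ne)) hs₂ hs₂₁)
  rcases F.flip₁.trichotomy with ⟨h₁, hc₁⟩ | ⟨h₁, hc₁⟩ | ⟨h₁, -⟩
  · rcases F.flip₁₂.trichotomy with ⟨-, hc₁₂⟩ | ⟨-, hc₁₂⟩ | ⟨h₁₂, -⟩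
    · grind
    · grind
    · exact g.partialDiff_partialDiff_eq_zero k (.inr h₁₂) _
  · rcases F.flip₁₂.trichotomy with ⟨h₁₂, hc₁₂⟩ | ⟨-, hc₁₂⟩ | ⟨h₁₂, -⟩
    · have hsingle : ¬Separated s₂ τ₁ ∧ ¬Separated t τ₁ := by grind
      rw [g.partialDiff_unit_of_split_merge k F.flip₁ F.flip₁₂ h₁ h₁₂,
        g.sumX_eq_zero k F.flip₂₁ hsingle.1 hsingle.2, LinearMap.zero_apply, smul_zero]
    · grind
    · exact g.partialDiff_partialDiff_eq_zero k (.inr h₁₂) _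
  · exact g.partialDiff_partialDiff_eq_zero k (.inl h₁) _

theorem anticomm_unit :
    g.partialDiff k κ s₁ t τ₂ (g.partialDiff k κ s s₁ τ₁ (unit k s)) =
      -g.partialDiff k κ s₂ t τ₁ (g.partialDiff k κ s s₂ τ₂ (unit k s)) := by
  by_cases hpath₂ : (¬Separated s τ₂ ∧ ¬Separated s₂ τ₂) ∨ (¬Separated s₂ τ₁ ∧ ¬Separated t τ₁)
  · rw [F.partialDiff_unit_eq_zero k g hpath₂, g.partialDiff_partialDiff_eq_zero k hpath₂, neg_zero]
  by_cases hpath₁ : (¬Separated s τ₁ ∧ ¬Separated s₁ τ₁) ∨ (¬Separated s₁ τ₂ ∧ ¬Separated t τ₂)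
  · rw [F.symm.partialDiff_unit_eq_zero k g hpath₁, g.partialDiff_partialDiff_eq_zero k hpath₁,
      neg_zero]
  rw [not_or] at hpath₁ hpath₂
  have h₁ := (or_assoc.2 F.flip₁.trichotomy).resolve_right fun h => hpath₁.1 h.1
  have h₁₂ := (or_assoc.2 F.flip₁₂.trichotomy).resolve_right fun h => hpath₁.2 h.1
  have h₂ := (or_assoc.2 F.flip₂.trichotomy).resolve_right fun h => hpath₂.1 h.1
  have h₂₁ := (or_assoc.2 F.flip₂₁.trichotomy).resolve_right fun h => hpath₂.2 h.1
  rcases h₁ with ⟨h₁, _⟩ | ⟨h₁, _⟩ <;> rcases h₁₂ with ⟨h₁₂, _⟩ | ⟨h₁₂, _⟩ <;>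
    rcases h₂ with ⟨h₂, _⟩ | ⟨h₂, _⟩ <;> rcases h₂₁ with ⟨h₂₁, _⟩ | ⟨h₂₁, _⟩ <;> try omega
  · exact F.anticomm_unit_of_merge_merge k g h₁ h₁₂ h₂ h₂₁
  · exact F.anticomm_unit_of_merge_split_of_merge_split k g h₁ h₁₂ h₂ h₂₁
  · exact F.anticomm_unit_of_merge_split_of_split_merge k g h₁ h₁₂ h₂ h₂₁
  · exact neg_eq_iff_eq_neg.1
      (F.symm.anticomm_unit_of_merge_split_of_split_merge k g h₂ h₂₁ h₁ h₁₂).symm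
  · exact F.anticomm_unit_of_split_merge_of_split_merge k g h₁ h₁₂ h₂ h₂₁
  · exact F.anticomm_unit_of_split_split k g h₁ h₁₂ h₂ h₂₁

theorem anticomm : g.partialDiff k κ s₁ t τ₂ ∘ₗ g.partialDiff k κ s s₁ τ₁ =
    -(g.partialDiff k κ s₂ t τ₁ ∘ₗ g.partialDiff k κ s s₂ τ₂) := by
  refine g.ext_unit k (κ := κ) (fun p x => ?_) (fun p x => ?_) (F.anticomm_unit k g)
  · simp only [LinearMap.comp_apply, g.partialDiff_opX k F.flip₁, g.partialDiff_opX k F.flip₁₂]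
  · simp only [LinearMap.neg_apply, LinearMap.comp_apply, g.partialDiff_opX k F.flip₂,
      g.partialDiff_opX k F.flip₂₁, map_neg]

end Face

end Anticommutativity

end Diagram

/-! ### The differential -/

theorem sum_offDiag_eq_zero {ι M : Type*} [AddCommGroup M] (S : Finset ι)
    {f : ι → ι → M} (hf : ∀ i ∈ S, ∀ j ∈ S, i ≠ j → f i j = -f j i) :
    ∑ p ∈ S.offDiag, f p.1 p.2 = 0 := by
  refine Finset.sum_involution (fun p _ => p.swap) (fun p hp => ?_) (fun p hp _ h => ?_)
    (fun p hp => ?_) fun p _ => p.swap_swap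
  · obtain ⟨h₁, h₂, hne⟩ := Finset.mem_offDiag.1 hp
    exact eq_neg_iff_add_eq_zero.1 (hf _ h₁ _ h₂ hne)
  · exact (Finset.mem_offDiag.1 hp).2.2 (congrArg Prod.snd h)
  · obtain ⟨h₁, h₂, hne⟩ := Finset.mem_offDiag.1 hp
    exact Finset.mem_offDiag.2 ⟨h₂, h₁, hne.symm⟩

namespace Diagram

variable {D : Diagram} {s : D.State} {τ₁ τ₂ : Fin D.n}

theorem face_update {a₁ a₂ : Smoothing} (hτ : τ₁ ≠ τ₂) (h₁ : s τ₁ ≠ a₁) (h₂ : s τ₂ ≠ a₂) :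
    Face τ₁ τ₂ s (Function.update s τ₁ a₁) (Function.update s τ₂ a₂)
      (Function.update (Function.update s τ₁ a₁) τ₂ a₂) where
  ne := hτ
  flip₁ := flipAt_update h₁
  flip₁₂ := flipAt_update (by rwa [Function.update_of_ne hτ.symm])
  flip₂ := flipAt_update h₂
  flip₂₁ := by
    rw [Function.update_comm hτ]
    exact flipAt_update (by rwa [Function.update_of_ne hτ])

namespace GlobalChoice

variable (k : Type*) [CommRing k] (g : D.GlobalChoice)

theorem differential_comp_self (κ : Convention) :
    g.differential k κ ∘ₗ g.differential k κ = 0 := by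
  refine LinearMap.ext fun x => funext fun t => ?_
  let S := Finset.univ.filter (t · = .B)
  let f (τ τ' : Fin D.n) : D.Chain k t :=
    g.partialDiff k κ (Function.update t τ .A) t τ
      (g.partialDiff k κ (Function.update (Function.update t τ .A) τ' .A)
        (Function.update t τ .A) τ' (x (Function.update (Function.update t τ .A) τ' .A)))
  have hsum : (g.differential k κ ∘ₗ g.differential k κ) x t = ∑ p ∈ S.offDiag, f p.1 p.2 := by
    rw [Finset.sum_finset_product S.offDiag S fun τ =>
      Finset.univ.filter (Function.update t τ Smoothing.A · = .B)]
    · simp [differential, S, f, LinearMap.sum_apply, map_sum]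
    · rintro ⟨τ, τ'⟩
      rcases eq_or_ne τ τ' with rfl | hne
      · simp
      · simp [S, hne, Function.update_of_ne hne.symm]
  rw [hsum]
  refine sum_offDiag_eq_zero S fun τ hτ τ' hτ' hne => ?_
  have hB {c : Fin D.n} (hc : c ∈ S) : t c ≠ .A := by
    rw [(Finset.mem_filter.1 hc).2]; exact Smoothing.noConfusion
  have hface := (face_update hne.symm (hB hτ') (hB hτ)).rotate.rotate.anticomm k g (κ := κ)
  simp only [f]
  rw [Function.update_comm hne]
  exact LinearMap.congr_fun hface _

end GlobalChoice

end Diagram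

end VirtualKhovanov

theorem mainTheorem4 (k : Type*) [CommRing k] (κ : VirtualKhovanov.Convention)
    (D : VirtualKhovanov.Diagram) (g : D.GlobalChoice) :
    (∀ (s : D.State) (τ₁ τ₂ : Fin D.n), τ₁ ≠ τ₂ →
      s τ₁ = VirtualKhovanov.Smoothing.A → s τ₂ = VirtualKhovanov.Smoothing.A →
      ∀ s₁ s₂ t : D.State,
        s₁ = Function.update s τ₁ VirtualKhovanov.Smoothing.B →
        s₂ = Function.update s τ₂ VirtualKhovanov.Smoothing.B →
        t = Function.update s₁ τ₂ VirtualKhovanov.Smoothing.B →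
        g.partialDiff k κ s₁ t τ₂ ∘ₗ g.partialDiff k κ s s₁ τ₁ =
          -(g.partialDiff k κ s₂ t τ₁ ∘ₗ g.partialDiff k κ s s₂ τ₂)) ∧
    g.differential k κ ∘ₗ g.differential k κ = 0 := by
  refine ⟨?_, g.differential_comp_self k κ⟩
  rintro s τ₁ τ₂ hτ h₁ h₂ _ _ _ rfl rfl rfl
  exact (VirtualKhovanov.Diagram.face_update hτ (by simp [h₁]) (by simp [h₂])).anticomm k g
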